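/- **Conventions.** Let $(\mathbb K,\oplus,\otimes,\bar 0,\bar 1)$ be a commutative semiring with a linear order $\preccurlyeq$ that is preserved by $\oplus$ and by multiplication with elements $a\succcurlyeq\bar 0$. It is *positively ordered* if $\bar 0\preccurlyeq a$ for all $a$, and *bipotent* if $a\oplus b\in\{a,b\}$ for all $a,b$. A *$\mathbb K$-weighted VSet-automaton* is $A=(\Sigma,V,Q,I,F,\delta)$ with a finite alphabet $\Sigma$, finite sets $V$ of variables and $Q$ of states, $I,F:Q\to\mathbb K$ and $\delta:Q\times(\Sigma\cup\{\varepsilon\}\cup\{{\vdash_v},{\dashv_v}\mid v\in V\})\times Q\to\mathbb K$. Its transitions are the triples with $\delta(p,o,q)\neq\bar 0$; there is no cycle of $\varepsilon$-transitions; $|A|$ is the number of states plus the number of transitions. A *run* on a document $d\in\Sigma^*$ is a sequence of transitions $q_0\xrightarrow{o_1}q_1\cdots\xrightarrow{o_m}q_m$ with $I(q_0)\ne\bar 0\neq F(q_m)$ whose letters spell $d$; its weight is $I(q_0)\otimes\bigotimes_j\delta(q_{j-1},o_j,q_j)\otimes F(q_m)$. It is *valid* if every $v\in V$ is opened ($\vdash_v$)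 exactly once, closed ($\dashv_v$) exactly once, and closed after it is opened; it then selects the tuple that maps each $v$ to the span $[i,j\rangle$, $1\le i\le j\le|d|+1$, of the positions at which $v$ is opened and closed. $A$ is *functional* if all its runs, on all documents, are valid. For a tuple $\mathbf t$ of spans of $d$, $[\![A]\!](d)(\mathbf t)$ is the $\oplus$-sum of the weights of the valid runs of nonzero weight on $d$ that select $\mathbf t$; we write $\mathbf t\in[\![A]\!](d)$ if this is not $\bar 0$. The machine model is a random access machine whose registers hold natural numbers or elements of $\mathbb K$; additions, truncated subtractions and comparisons of numbers, additions, multiplications and $\preccurlyeq$-comparisons in $\mathbb K$, and direct or indirect register accesses take one step each. The input lists $A$ (with letters, variables and states numbered, and the transitions in any order) and $d$. **Theorem.** There are a program and polynomials $p,q$ such that, for every positively ordered, bipotent commutative semiring $\mathbb K$, every functional $\mathbb K$-weighted VSet-automaton $A$ (without $\varepsilon$-cycles) and every document $d$ over its alphabet, the program on input $(A,d)$ halts after writing each tuple $\mathbf t\in[\![A]\!](d)$ precisely once, in descending (that is, non-increasing) order of the weights $[\![A]\!](d)(\mathbf t)$. It takes at most $p(|A|+|d|)$ steps before the first symbol of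 the first answer (or before halting, if there is no answer), and at most $q(|A|+|d|)$ steps from the first symbol of each answer to the first symbol of the next answer (or to halting, after the last answer). -/

import Mathlib

/-! ## Weighted variable-set automata -/

/-- Transition labels over the alphabet `α` and the variables `V`: `ε`, a letter, or one of the
variable operations `v⊢` (open `v`) and `⊣v` (close `v`). -/
inductive VSetLabel (α V : Type*) where
  | eps : VSetLabel α V
  | letter (a : α) : VSetLabel α V
  | opening (v : V) : VSetLabel α V
  | closing (v : V) : VSetLabel α V

namespace VSetLabel

/-- The letter read by a label, if any. -/
def letter? {α V : Type*} : VSetLabel α V → Option α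
  | letter a => some a
  | _ => none

end VSetLabel

/-- A `K`-weighted variable-set automaton with alphabet `α`, variables `V` and states `Q` (these
three types are assumed finite where the automaton is used). -/
structure WeightedVSA (K α V Q : Type*) where
  /-- the initial weight function -/
  init : Q → K
  /-- the final weight function -/
  final : Q → K
  /-- the weighted transition function -/
  trans : Q → VSetLabel α V → Q → K

/-- `Spans(d)`: the pairs `(i, j)` with `1 ≤ i ≤ j ≤ |d| + 1`. -/
def DocSpan {α : Type*} (d : List α) : Type :=
  {s : ℕ × ℕ // 1 ≤ s.1 ∧ s.1 ≤ s.2 ∧ s.2 ≤ d.length + 1}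

/-- A sequence `q₀ -o₁→ q₁ -o₂→ ⋯ -oₘ→ qₘ`, stored as `q₀` and the list of the `(oⱼ, qⱼ)`. -/
structure VSetPath (α V Q : Type*) where
  start : Q
  steps : List (VSetLabel α V × Q)

namespace VSetPath

variable {α V Q : Type*}

/-- The sequence `o₁, …, oₘ` (with indices starting at `0`). -/
def labels (ρ : VSetPath α V Q) : List (VSetLabel α V) := ρ.steps.map Prod.fst

/-- The position in the document just before the label with index `j` is processed: `1` plus the
number of letters read before. -/
def pos (ρ : VSetPath α V Q) (j : ℕ) : ℕ :=
  1 + ((ρ.labels.take j).filterMap VSetLabel.letter?).length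

/-- Every variable is opened exactly once and closed exactly once, and closed after it has been
opened. -/
def Valid (ρ : VSetPath α V Q) : Prop :=
  ∀ v : V, ∃ i j : ℕ, i < j ∧
    (∀ k : ℕ, ρ.labels[k]? = some (VSetLabel.opening v) ↔ k = i) ∧
    (∀ k : ℕ, ρ.labels[k]? = some (VSetLabel.closing v) ↔ k = j)

/-- `t` is the tuple `t_ρ` of `ρ`: the span of `v` goes from the position at which `v` is opened
to the position at which `v` is closed. -/
def Selects {d : List α} (ρ : VSetPath α V Q) (t : V → DocSpan d) : Prop :=
  ∀ v : V, ∃ i j : ℕ, ρ.labels[i]? = some (VSetLabel.opening v) ∧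
    ρ.labels[j]? = some (VSetLabel.closing v) ∧ (t v).1 = (ρ.pos i, ρ.pos j)

end VSetPath

namespace WeightedVSA

variable {K α V Q : Type*} [CommSemiring K]

/-- `steps` is a sequence of transitions from the given state to an accepting state. -/
def IsAcceptingFrom (A : WeightedVSA K α V Q) : Q → List (VSetLabel α V × Q) → Prop
  | p, [] => A.final p ≠ 0
  | p, (o, q) :: l => A.trans p o q ≠ 0 ∧ A.IsAcceptingFrom q l

/-- The product of the transition weights along the steps and of the final weight. -/
def weightFrom (A : WeightedVSA K α V Q) : Q → List (VSetLabel α V × Q) → K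
  | p, [] => A.final p
  | p, (o, q) :: l => A.trans p o q * A.weightFrom q l

/-- `ρ` is a run of `A` on `d`: it goes along transitions from an initial to an accepting state,
and the letters that it reads, in this order, spell `d`. -/
def IsRun (A : WeightedVSA K α V Q) (d : List α) (ρ : VSetPath α V Q) : Prop :=
  A.init ρ.start ≠ 0 ∧ A.IsAcceptingFrom ρ.start ρ.steps ∧
    ρ.labels.filterMap VSetLabel.letter? = d

/-- The weight `I(q₀) ⊗ δ(q₀, o₁, q₁) ⊗ ⋯ ⊗ δ(qₘ₋₁, oₘ, qₘ) ⊗ F(qₘ)`. -/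
def weight (A : WeightedVSA K α V Q) (ρ : VSetPath α V Q) : K :=
  A.init ρ.start * A.weightFrom ρ.start ρ.steps

/-- The set `R(A, d)` of the valid and nonzero runs of `A` on `d`. -/
def runs (A : WeightedVSA K α V Q) (d : List α) : Set (VSetPath α V Q) :=
  {ρ | A.IsRun d ρ ∧ ρ.Valid ∧ A.weight ρ ≠ 0}

/-- All runs, on all documents, are valid. -/
def Functional (A : WeightedVSA K α V Q) : Prop :=
  ∀ (d : List α) (ρ : VSetPath α V Q), A.IsRun d ρ → ρ.Valid

/-- There is no cycle of `ε`-transitions. -/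
def NoEpsCycles (A : WeightedVSA K α V Q) : Prop :=
  ∀ q : Q, ¬ Relation.TransGen (fun p p' => A.trans p VSetLabel.eps p' ≠ 0) q q

/-- Without `ε`-cycles, a path to an accepting state has bounded length in terms of the number of
its labels other than `ε`. -/
theorem exists_length_bound [Finite Q] (A : WeightedVSA K α V Q) (hA : A.NoEpsCycles) :
    ∃ h : Q → ℕ, (∀ q, h q ≤ Nat.card Q) ∧ ∀ (l : List (VSetLabel α V × Q)) (p : Q),
      A.IsAcceptingFrom p l →
      ∃ w : List (VSetLabel α V), w.Sublist (l.map Prod.fst) ∧ VSetLabel.eps ∉ w ∧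
        l.length ≤ w.length * (Nat.card Q + 1) + h p := by
  classical
  let r : Q → Q → Prop := Relation.TransGen (fun p p' => A.trans p VSetLabel.eps p' ≠ 0)
  refine ⟨fun q => {p | r q p}.ncard, fun q => ?_, fun l => ?_⟩
  · exact (Set.ncard_le_ncard (Set.subset_univ _)).trans (Set.ncard_univ Q).le
  · induction l with
    | nil => intro p _; exact ⟨[], by simp⟩
    | cons x l ih =>
      obtain ⟨o, q⟩ := x
      rintro p ⟨ho, hl⟩
      obtain ⟨w, hw, hw', hle⟩ := ih q hl
      by_cases hoe : o = VSetLabel.eps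
      · subst hoe
        refine ⟨w, hw.cons _, hw', ?_⟩
        have hlt : {p' | r q p'}.ncard < {p' | r p p'}.ncard := by
          refine Set.ncard_lt_ncard ⟨fun x hx => ?_, fun hsub => ?_⟩
          · exact Relation.TransGen.head ho hx
          · exact hA q (hsub (Relation.TransGen.single ho))
        simp only [List.length_cons] at hle ⊢
        omega
      · refine ⟨o :: w, by simpa using hw, by simpa [Ne.symm hoe] using hw', ?_⟩
        have hq : {p' | r q p'}.ncard ≤ Nat.card Q :=
          (Set.ncard_le_ncard (Set.subset_univ _)).trans (Set.ncard_univ Q).le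
        simp only [List.length_cons, add_mul, one_mul, mul_add, mul_one] at hle ⊢
        omega

/-- Without `ε`-cycles there are finitely many valid runs on a document. -/
theorem finite_runs [Finite α] [Finite V] [Finite Q] (A : WeightedVSA K α V Q)
    (hA : A.NoEpsCycles) (d : List α) : (A.runs d).Finite := by
  classical
  have : Finite (VSetLabel α V) := by
    refine Finite.of_injective (β := Option (α ⊕ V ⊕ V)) (fun o => match o with
      | .eps => none
      | .letter a => some (.inl a)
      | .opening v => some (.inr (.inl v))
      | .closing v => some (.inr (.inr v))) ?_
    rintro (_ | _ | _ | _) (_ | _ | _ | _) h <;> simp_all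
  obtain ⟨h, hc, hb⟩ := A.exists_length_bound hA
  let N := (d.length + Nat.card (VSetLabel α V)) * (Nat.card Q + 1) + Nat.card Q
  have hfin : (Set.univ ×ˢ {l : List (VSetLabel α V × Q) | l.length ≤ N} :
      Set (Q × List (VSetLabel α V × Q))).Finite :=
    Set.finite_univ.prod (List.finite_length_le _ _)
  refine Set.Finite.subset (hfin.image fun x => ⟨x.1, x.2⟩) ?_
  rintro ⟨q, l⟩ ⟨⟨-, hacc, hd⟩, hv, -⟩
  refine ⟨(q, l), ⟨trivial, ?_⟩, rfl⟩
  obtain ⟨w, hw, hwe, hle⟩ := hb l q hacc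
  have hsplit := List.length_eq_length_filter_add (l := w) (fun o => o.letter?.isSome)
  have h1 : (w.filter fun o => o.letter?.isSome).length ≤ d.length := by
    rw [← hd]
    have := (hw.filterMap VSetLabel.letter?).length_le
    rwa [List.length_filterMap_eq_countP, List.countP_eq_length_filter] at this
  have h2 : (w.filter fun o => !o.letter?.isSome).length ≤ Nat.card (VSetLabel α V) := by
    have hnd : (w.filter fun o => !o.letter?.isSome).Nodup := by
      rw [List.nodup_iff_count_le_one]
      intro o
      by_cases ho : o ∈ w.filter fun o => !o.letter?.isSome
      · rw [List.mem_filter] at ho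
        refine (List.Sublist.count_le _ (List.filter_sublist.trans hw)).trans ?_
        have key : ∃ i : ℕ, ∀ k : ℕ, (l.map Prod.fst)[k]? = some o ↔ k = i := by
          rcases o with _ | a | v | v
          · exact absurd ho.1 hwe
          · simp [VSetLabel.letter?] at ho
          · obtain ⟨i, j, -, hi, -⟩ := hv v
            exact ⟨i, hi⟩
          · obtain ⟨i, j, -, -, hj⟩ := hv v
            exact ⟨j, hj⟩
        obtain ⟨i, hi⟩ := key
        by_contra hlt
        push Not at hlt
        have hdup := List.duplicate_iff_two_le_count.2 (Nat.succ_le_of_lt hlt)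
        rw [List.duplicate_iff_exists_distinct_get] at hdup
        obtain ⟨n, m, hnm, hn, hm⟩ := hdup
        have e1 := (hi n).1 (by rw [List.getElem?_eq_getElem n.2]; simpa using hn.symm)
        have e2 := (hi m).1 (by rw [List.getElem?_eq_getElem m.2]; simpa using hm.symm)
        exact absurd hnm (by simp [Fin.lt_def, e1, e2])
      · rw [List.count_eq_zero_of_not_mem ho]; omega
    have : Fintype (VSetLabel α V) := Fintype.ofFinite _
    rw [Nat.card_eq_fintype_card]
    exact hnd.length_le_card
  have h3 : w.length ≤ d.length + Nat.card (VSetLabel α V) := by omega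
  calc l.length ≤ w.length * (Nat.card Q + 1) + h q := hle
    _ ≤ N := Nat.add_le_add (Nat.mul_le_mul_right _ h3) (hc q)

/-- The `(K, d)`-relation `⟦A⟧(d)`: the weight of a tuple is the sum of the weights of its valid
nonzero runs. See `finite_runs`: without `ε`-cycles this is a finite sum. -/
noncomputable def eval (A : WeightedVSA K α V Q) (d : List α) (t : V → DocSpan d) : K :=
  ∑ᶠ ρ ∈ {ρ | ρ ∈ A.runs d ∧ ρ.Selects t}, A.weight ρ

/-- `|A|`: the number of states plus the number of transitions. -/
noncomputable def size (A : WeightedVSA K α V Q) : ℕ :=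
  Nat.card Q + {x : Q × VSetLabel α V × Q | A.trans x.1 x.2.1 x.2.2 ≠ 0}.ncard

end WeightedVSA

/-! ## Random access machines with semiring registers

There are registers for natural numbers and registers for semiring elements. Both are organized
in arrays; the name of an array is a constant of the program (so that a program uses finitely many
arrays), an index is computed. Additions, truncated subtractions and comparisons of numbers,
semiring additions, multiplications and comparisons, and register accesses take one step each. -/

/-- The contents of the registers. -/
structure RamStore (K : Type*) where
  num : ℕ → ℕ → ℕ
  wt : ℕ → ℕ → K

/-- Numerical expressions. -/
inductive RamNum where
  | const (n : ℕ) : RamNum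
  | load (array : ℕ) (index : RamNum) : RamNum
  | add (e e' : RamNum) : RamNum
  | sub (e e' : RamNum) : RamNum

/-- Expressions for semiring elements. -/
inductive RamWt where
  | zero : RamWt
  | one : RamWt
  | load (array : ℕ) (index : RamNum) : RamWt
  | add (e e' : RamWt) : RamWt
  | mul (e e' : RamWt) : RamWt

/-- Tests. -/
inductive RamTest where
  | numLE (e e' : RamNum) : RamTest
  | wtLE (e e' : RamWt) : RamTest
  | not (b : RamTest) : RamTest

/-- Programs. -/
inductive RamProg where
  | skip : RamProg
  | setNum (array : ℕ) (index e : RamNum) : RamProg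
  | setWt (array : ℕ) (index : RamNum) (e : RamWt) : RamProg
  | write (e : RamNum) : RamProg
  | seq (c c' : RamProg) : RamProg
  | ite (b : RamTest) (c c' : RamProg) : RamProg
  | while (b : RamTest) (c : RamProg) : RamProg

namespace RamNum

/-- The number of steps for the evaluation: the number of nodes of the expression. -/
def cost : RamNum → ℕ
  | const _ => 1
  | load _ e => e.cost + 1
  | add e e' => e.cost + e'.cost + 1
  | sub e e' => e.cost + e'.cost + 1

/-- The value in a given store. -/
def val {K : Type*} (s : RamStore K) : RamNum → ℕ
  | const n => n
  | load a e => s.num a (e.val s)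
  | add e e' => e.val s + e'.val s
  | sub e e' => e.val s - e'.val s

end RamNum

namespace RamWt

/-- The number of steps for the evaluation. -/
def cost : RamWt → ℕ
  | zero => 1
  | one => 1
  | load _ e => e.cost + 1
  | add e e' => e.cost + e'.cost + 1
  | mul e e' => e.cost + e'.cost + 1

/-- The value in a given store. -/
def val {K : Type*} [CommSemiring K] (s : RamStore K) : RamWt → K
  | zero => 0
  | one => 1
  | load a e => s.wt a (e.val s)
  | add e e' => e.val s + e'.val s
  | mul e e' => e.val s * e'.val s

end RamWt

namespace RamTest

/-- The number of steps for the evaluation. -/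
def cost : RamTest → ℕ
  | numLE e e' => e.cost + e'.cost + 1
  | wtLE e e' => e.cost + e'.cost + 1
  | not b => b.cost + 1

/-- The truth value in a given store. -/
def Holds {K : Type*} [CommSemiring K] [LinearOrder K] (s : RamStore K) : RamTest → Prop
  | numLE e e' => e.val s ≤ e'.val s
  | wtLE e e' => e.val s ≤ e'.val s
  | not b => ¬ b.Holds s

end RamTest

namespace RamStore

variable {K : Type*}

/-- Write a number into a register. -/
def setNum (s : RamStore K) (array index value : ℕ) : RamStore K :=
  { s with num := Function.update s.num array (Function.update (s.num array) index value) }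

/-- Write a semiring element into a register. -/
def setWt (s : RamStore K) (array index : ℕ) (value : K) : RamStore K :=
  { s with wt := Function.update s.wt array (Function.update (s.wt array) index value) }

end RamStore

/-- A protocol of the steps of a computation: an entry `some n` is a step in which the symbol `n`
is written to the output, an entry `none` is any other step. -/
abbrev RamTrace := List (Option ℕ)

/-- `n` steps without output. -/
def RamTrace.silent (n : ℕ) : RamTrace := List.replicate n none

/-- `Exec c s T s'`: started in `s`, the program `c` halts in `s'` after the steps `T`. -/
inductive RamProg.Exec {K : Type*} [CommSemiring K] [LinearOrder K] :
    RamProg → RamStore K → RamTrace → RamStore K → Prop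
  | skip (s : RamStore K) : Exec .skip s (.silent 1) s
  | setNum (a : ℕ) (i e : RamNum) (s : RamStore K) :
      Exec (.setNum a i e) s (.silent (i.cost + e.cost + 1)) (s.setNum a (i.val s) (e.val s))
  | setWt (a : ℕ) (i : RamNum) (e : RamWt) (s : RamStore K) :
      Exec (.setWt a i e) s (.silent (i.cost + e.cost + 1)) (s.setWt a (i.val s) (e.val s))
  | write (e : RamNum) (s : RamStore K) :
      Exec (.write e) s (.silent e.cost ++ [some (e.val s)]) s
  | seq {c c' : RamProg} {s s' s'' : RamStore K} {T T' : RamTrace} :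
      Exec c s T s' → Exec c' s' T' s'' → Exec (.seq c c') s (T ++ T') s''
  | ite_true {b : RamTest} {c c' : RamProg} {s s' : RamStore K} {T : RamTrace} :
      b.Holds s → Exec c s T s' → Exec (.ite b c c') s (.silent b.cost ++ T) s'
  | ite_false {b : RamTest} {c c' : RamProg} {s s' : RamStore K} {T : RamTrace} :
      ¬ b.Holds s → Exec c' s T s' → Exec (.ite b c c') s (.silent b.cost ++ T) s'
  | while_true {b : RamTest} {c : RamProg} {s s' s'' : RamStore K} {T T' : RamTrace} :
      b.Holds s → Exec c s T s' → Exec (.while b c) s' T' s'' →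
      Exec (.while b c) s (.silent b.cost ++ T ++ T') s''
  | while_false {b : RamTest} {c : RamProg} {s : RamStore K} :
      ¬ b.Holds s → Exec (.while b c) s (.silent b.cost) s

/-! ## Automata and documents as inputs, tuples as outputs -/

/-- What is needed to write `A` down: numberings of the letters, variables and states, and a list
of the transitions in any order. -/
structure WeightedVSA.Listing {K α V Q : Type*} [CommSemiring K] (A : WeightedVSA K α V Q) where
  letter : α ≃ Fin (Nat.card α)
  var : V ≃ Fin (Nat.card V)
  state : Q ≃ Fin (Nat.card Q)
  transitions : List (Q × VSetLabel α V × Q)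
  nodup : transitions.Nodup
  mem_iff : ∀ p o q, (p, o, q) ∈ transitions ↔ A.trans p o q ≠ 0

namespace WeightedVSA.Listing

variable {K α V Q : Type*} [CommSemiring K] {A : WeightedVSA K α V Q} (L : A.Listing)

/-- The kind of a label. -/
def kindCode : VSetLabel α V → ℕ
  | .eps => 0
  | .letter _ => 1
  | .opening _ => 2
  | .closing _ => 3

/-- The number of the letter or variable of a label. -/
def argCode : VSetLabel α V → ℕ
  | .eps => 0
  | .letter a => L.letter a
  | .opening v => L.var v
  | .closing v => L.var v

/-- The array that starts with the entries of `l` and is filled up with zeros. -/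
def arrayOf {β : Type*} [Zero β] (l : List β) : ℕ → β := fun i => (l[i]?).getD 0

/-- The initial store. Number array `0` holds `|Q|`, `|Σ|`, `|V|`, `|d|` and the number of
transitions, array `1` holds the document, and arrays `2` to `5` hold the sources, kinds, letters
or variables, and targets of the transitions. Semiring arrays `0`, `1`, `2` hold the initial
weights, the final weights and the weights of the transitions. All else is zero. -/
noncomputable def input (d : List α) : RamStore K where
  num
    | 0 => arrayOf [Nat.card Q, Nat.card α, Nat.card V, d.length, L.transitions.length]
    | 1 => arrayOf (d.map fun a => (L.letter a : ℕ))
    | 2 => arrayOf (L.transitions.map fun x => (L.state x.1 : ℕ))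
    | 3 => arrayOf (L.transitions.map fun x => kindCode x.2.1)
    | 4 => arrayOf (L.transitions.map fun x => L.argCode x.2.1)
    | 5 => arrayOf (L.transitions.map fun x => (L.state x.2.2 : ℕ))
    | _ => fun _ => 0
  wt
    | 0 => arrayOf (List.ofFn fun i => A.init (L.state.symm i))
    | 1 => arrayOf (List.ofFn fun i => A.final (L.state.symm i))
    | 2 => arrayOf (L.transitions.map fun x => A.trans x.1 x.2.1 x.2.2)
    | _ => fun _ => 0

/-- A tuple as a word: the bounds of the spans of the variables, in the order of the variables,
and the end mark `0` (a span bound is never `0`). -/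
noncomputable def tupleWord {d : List α} (t : V → DocSpan d) : List ℕ :=
  (List.ofFn fun i => [(t (L.var.symm i)).1.1, (t (L.var.symm i)).1.2]).flatten ++ [0]

end WeightedVSA.Listing

/-- The computation `T` writes exactly the words of the list `out`, one after the other. Before the
first symbol of the first word (or before halting if `out` is empty) there are at most `p` steps.
From the first symbol of a word to the first symbol of the next word (or to halting, for the last
word) there are at most `q` steps. -/
def RamTrace.Enumerates (T : RamTrace) (out : List (List ℕ)) (p q : ℕ) : Prop :=
  ∃ (n : ℕ) (blocks : List RamTrace),
    T = RamTrace.silent n ++ blocks.flatten ∧ n ≤ p ∧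
    List.Forall₂ (fun (B : RamTrace) (w : List ℕ) =>
      (∃ x B', B = some x :: B') ∧ B.reduceOption = w ∧ B.length ≤ q) blocks out

/-- `ts` lists precisely once each tuple with nonzero weight in `⟦A⟧(d)`, by descending weight. -/
def WeightedVSA.IsRankedList {K α V Q : Type*} [CommSemiring K] [LinearOrder K]
    (A : WeightedVSA K α V Q) (d : List α) (ts : List (V → DocSpan d)) : Prop :=
  ts.Nodup ∧ (∀ t, t ∈ ts ↔ A.eval d t ≠ 0) ∧
    ts.Pairwise fun t t' => A.eval d t' ≤ A.eval d t

/-- On the input given by `A` (listed by `L`) and `d`, the program `P` enumerates the tuples in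
`⟦A⟧(d)` by descending weight, and halts, with at most `p` steps of preprocessing and delay `q`. -/
def RamProg.RankedEnumerates {K α V Q : Type*} [CommSemiring K] [LinearOrder K] (P : RamProg)
    (A : WeightedVSA K α V Q) (L : A.Listing) (d : List α) (p q : ℕ) : Prop :=
  ∃ (ts : List (V → DocSpan d)) (T : RamTrace) (s : RamStore K),
    A.IsRankedList d ts ∧ P.Exec (L.input d) T s ∧ T.Enumerates (ts.map L.tupleWord) p q

/-! In a positively ordered bipotent semiring a finite sum is the maximum of its summands, or `0` if
there are none. Hence the weight of a tuple is the best weight of a run that selects it, and ranked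
enumeration is a repeated search for a best remaining answer.

Write a tuple as the word of its `2|V|` span bounds. A prefix of such a word prescribes positions
for some of the variable operations. A best run that obeys the prescription is found by dynamic
programming over pairs of a document position and a state (`ensures_bestRun`). Functionality is
essential here (`bestRunFinds`): every run found is valid, so it selects a tuple, and obeying the
prescription means that the word of this tuple extends the prefix (`isPath_iff_isPrefix`). Without
`ε`-cycles, runs have polynomial length, so polynomially many rounds of relaxation suffice
(`length_steps_le`).

The answers are organized as a lazily built tree of prefixes. Each node carries the best weight of
the answers below it that have not been written. For the next answer, go down from the root, always
to a child that is worth no less than its parent; a node without children is expanded first, by one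
call of the dynamic program for each child. Nothing below such a node has been written, so these
calls need not know the answers given so far. The word at depth `2|V|` is a best remaining answer.
After it has been written, its node gets the value `0` and the maxima on its path are recomputed
from the bottom up (`ensures_retract`). One answer thus costs at most `2|V|(|d|+1)` calls of the
dynamic program. The loop ends when the root has value `0`.

The size of `A` does not count variables, but a single valid run already forces a transition for
each of them (`card_var_le`). The program therefore runs through the variables only once it knows
that an answer exists.

Step counts come from the syntax: `costPoly` is a polynomial in a common bound `Y` for the
iterations of each counting loop, and `Y` is itself polynomial in the input size. -/

/-! ## Reasoning about silent programs -/

namespace RamStore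

variable {K : Type*} (s : RamStore K)

@[simp] theorem setNum_num_self (a i v : ℕ) :
    (s.setNum a i v).num a = Function.update (s.num a) i v := by
  simp [setNum]

@[simp] theorem setNum_num_of_ne {a b : ℕ} (h : b ≠ a) (i v : ℕ) :
    (s.setNum a i v).num b = s.num b := by
  simp [setNum, h]

@[simp] theorem setNum_wt (a i v : ℕ) : (s.setNum a i v).wt = s.wt := rfl

@[simp] theorem setWt_wt_self (a i : ℕ) (v : K) :
    (s.setWt a i v).wt a = Function.update (s.wt a) i v := by
  simp [setWt]

@[simp] theorem setWt_wt_of_ne {a b : ℕ} (h : b ≠ a) (i : ℕ) (v : K) :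
    (s.setWt a i v).wt b = s.wt b := by
  simp [setWt, h]

@[simp] theorem setWt_num (a i : ℕ) (v : K) : (s.setWt a i v).num = s.num := rfl

end RamStore

/-- The arrays that an expression reads. -/
def RamNum.arrays : RamNum → List ℕ
  | const _ => []
  | load a e => a :: e.arrays
  | add e e' => e.arrays ++ e'.arrays
  | sub e e' => e.arrays ++ e'.arrays

theorem RamNum.val_congr {K : Type*} {s s' : RamStore K} (e : RamNum)
    (h : ∀ a ∈ e.arrays, s'.num a = s.num a) : e.val s' = e.val s := by
  induction e with
  | const n => rfl
  | load a e ih =>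
    simp only [arrays, List.mem_cons, forall_eq_or_imp] at h
    simp only [val, ih h.2, h.1]
  | add e e' ih ih' =>
    simp only [arrays, List.mem_append] at h
    simp only [val, ih fun a ha => h a (.inl ha), ih' fun a ha => h a (.inr ha)]
  | sub e e' ih ih' =>
    simp only [arrays, List.mem_append] at h
    simp only [val, ih fun a ha => h a (.inl ha), ih' fun a ha => h a (.inr ha)]

namespace RamTrace

theorem silent_add (m n : ℕ) : silent (m + n) = silent m ++ silent n :=
  List.replicate_add ..

@[simp] theorem length_silent (n : ℕ) : (silent n).length = n := by simp [silent]

@[simp] theorem reduceOption_silent (n : ℕ) : (silent n).reduceOption = [] := by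
  simp [silent]

end RamTrace

namespace RamProg

/-- The number arrays that a program may modify. -/
def numMods : RamProg → List ℕ
  | setNum a _ _ => [a]
  | seq c c' => c.numMods ++ c'.numMods
  | ite _ c c' => c.numMods ++ c'.numMods
  | .while _ c => c.numMods
  | _ => []

/-- The semiring arrays that a program may modify. -/
def wtMods : RamProg → List ℕ
  | setWt a _ _ => [a]
  | seq c c' => c.wtMods ++ c'.wtMods
  | ite _ c c' => c.wtMods ++ c'.wtMods
  | .while _ c => c.wtMods
  | _ => []

/-- The two stores agree on all arrays that `c` does not modify. -/
structure Frame {K : Type*} (c : RamProg) (s s' : RamStore K) : Prop where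
  num : ∀ a, a ∉ c.numMods → s'.num a = s.num a
  wt : ∀ a, a ∉ c.wtMods → s'.wt a = s.wt a

theorem Frame.refl {K : Type*} (c : RamProg) (s : RamStore K) : c.Frame s s :=
  ⟨fun _ _ => rfl, fun _ _ => rfl⟩

theorem Frame.trans {K : Type*} {c : RamProg} {s s' s'' : RamStore K} (h : c.Frame s s')
    (h' : c.Frame s' s'') : c.Frame s s'' :=
  ⟨fun a ha => (h'.num a ha).trans (h.num a ha), fun a ha => (h'.wt a ha).trans (h.wt a ha)⟩

theorem Frame.mono {K : Type*} {c c' : RamProg} {s s' : RamStore K} (h : c.Frame s s')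
    (hn : c.numMods ⊆ c'.numMods) (hw : c.wtMods ⊆ c'.wtMods) : c'.Frame s s' :=
  ⟨fun a ha => h.num a fun h' => ha (hn h'), fun a ha => h.wt a fun h' => ha (hw h')⟩

section

variable {K : Type*} [CommSemiring K] [LinearOrder K]

/-- The modified arrays are read off the syntax. For a concrete program, `decide` therefore settles
that an array keeps its contents, and this is how all invariants below survive the parts of the
program that do not concern them. -/
theorem Exec.frame {c : RamProg} {s s' : RamStore K} {T : RamTrace} (h : Exec c s T s') :
    c.Frame s s' := by
  induction h with
  | skip => exact .refl _ _
  | setNum a i e s =>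
    refine ⟨fun b hb => ?_, fun b _ => rfl⟩
    simp only [numMods, List.mem_singleton] at hb
    simp [hb]
  | setWt a i e s =>
    refine ⟨fun b _ => rfl, fun b hb => ?_⟩
    simp only [wtMods, List.mem_singleton] at hb
    simp [hb]
  | write => exact .refl _ _
  | seq _ _ ih ih' =>
    exact (ih.mono (by simp [numMods]) (by simp [wtMods])).trans
      (ih'.mono (by simp [numMods]) (by simp [wtMods]))
  | ite_true _ _ ih => exact ih.mono (by simp [numMods]) (by simp [wtMods])
  | ite_false _ _ ih => exact ih.mono (by simp [numMods]) (by simp [wtMods])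
  | while_true _ _ _ ih ih' => exact (ih.mono (by simp [numMods]) (by simp [wtMods])).trans ih'
  | while_false => exact .refl _ _

/-- A bound on the number of steps, in terms of a bound on the numbers of iterations of loops. -/
noncomputable def costPoly : RamProg → Polynomial ℕ
  | skip => 1
  | setNum _ i e => Polynomial.C (i.cost + e.cost + 1)
  | setWt _ i e => Polynomial.C (i.cost + e.cost + 1)
  | write e => Polynomial.C (e.cost + 1)
  | seq c c' => c.costPoly + c'.costPoly
  | ite b c c' => Polynomial.C b.cost + c.costPoly + c'.costPoly
  | .while b c => (Polynomial.X + 1) * (Polynomial.C b.cost + c.costPoly)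

/-- Started in `s`, the program `c` halts without output and within the step bound for loops of at
most `Y` iterations, in a store with the property `P`. -/
def Ensures (Y : ℕ) (c : RamProg) (P : RamStore K → Prop) (s : RamStore K) : Prop :=
  ∃ (m : ℕ) (s' : RamStore K), m ≤ c.costPoly.eval Y ∧ Exec c s (.silent m) s' ∧ P s'

namespace Ensures

variable {Y : ℕ} {c c' : RamProg} {P P' : RamStore K → Prop} {s : RamStore K}

theorem mono (h : Ensures Y c P s) (hP : ∀ s', c.Frame s s' → P s' → P' s') :
    Ensures Y c P' s := by
  obtain ⟨m, s', hm, he, h⟩ := h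
  exact ⟨m, s', hm, he, hP s' he.frame h⟩

theorem skip (h : P s) : Ensures Y .skip P s :=
  ⟨1, s, by simp [costPoly], .skip s, h⟩

theorem setNum {a : ℕ} {i e : RamNum} (h : P (s.setNum a (i.val s) (e.val s))) :
    Ensures Y (.setNum a i e) P s :=
  ⟨_, _, by simp [costPoly], .setNum a i e s, h⟩

theorem setWt {a : ℕ} {i : RamNum} {e : RamWt} (h : P (s.setWt a (i.val s) (e.val s))) :
    Ensures Y (.setWt a i e) P s :=
  ⟨_, _, by simp [costPoly], .setWt a i e s, h⟩

/-- Nesting the assertions makes `Ensures` behave like a weakest precondition: a proof can follow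
the program instruction by instruction. -/
theorem seq (h : Ensures Y c (Ensures Y c' P) s) : Ensures Y (.seq c c') P s := by
  obtain ⟨m, s', hm, he, m', s'', hm', he', h⟩ := h
  refine ⟨m + m', s'', by simp [costPoly]; omega, ?_, h⟩
  rw [RamTrace.silent_add]
  exact .seq he he'

theorem ite {b : RamTest} (h : b.Holds s → Ensures Y c P s) (h' : ¬ b.Holds s → Ensures Y c' P s) :
    Ensures Y (.ite b c c') P s := by
  by_cases hb : b.Holds s
  · obtain ⟨m, s', hm, he, h⟩ := h hb
    refine ⟨b.cost + m, s', by simp [costPoly]; omega, ?_, h⟩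
    rw [RamTrace.silent_add]
    exact .ite_true hb he
  · obtain ⟨m, s', hm, he, h⟩ := h' hb
    refine ⟨b.cost + m, s', by simp [costPoly]; omega, ?_, h⟩
    rw [RamTrace.silent_add]
    exact .ite_false hb he

/-- Induction on the number `j` of iterations still to come. There are `n + 1` tests and `n`
executions of the body, which the factor `X + 1` in `costPoly` covers. -/
theorem while_iterate {b : RamTest} (n : ℕ) (hn : n ≤ Y) (I : ℕ → RamStore K → Prop)
    (h0 : I 0 s)
    (htest : ∀ k s', k ≤ n → I k s' → (.while b c : RamProg).Frame s s' → (b.Holds s' ↔ k < n))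
    (hstep : ∀ k s', k < n → I k s' → (.while b c : RamProg).Frame s s' →
      Ensures Y c (I (k + 1)) s')
    (hP : ∀ s', I n s' → (.while b c : RamProg).Frame s s' → P s') :
    Ensures Y (.while b c) P s := by
  have key : ∀ j ≤ n, ∀ s', I (n - j) s' → (.while b c : RamProg).Frame s s' →
      ∃ m s'', m ≤ (j + 1) * b.cost + j * c.costPoly.eval Y ∧
        Exec (.while b c) s' (.silent m) s'' ∧ P s'' := by
    intro j
    induction j with
    | zero =>
      intro _ s' hI hF
      exact ⟨b.cost, s', by simp, .while_false (by simp [htest n s' le_rfl hI hF]), hP s' hI hF⟩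
    | succ j ih =>
      intro hj s' hI hF
      obtain ⟨m, s₁, hm, he, hI'⟩ := hstep _ s' (by omega) hI hF
      have hF' : (.while b c : RamProg).Frame s s₁ :=
        hF.trans (he.frame.mono (by simp [numMods]) (by simp [wtMods]))
      obtain ⟨m', s₂, hm', he', hP'⟩ := ih (by omega) s₁ (by convert hI' using 1; omega) hF'
      refine ⟨b.cost + m + m', s₂, ?_, ?_, hP'⟩
      · simp only [add_mul, one_mul] at hm' ⊢
        omega
      · rw [RamTrace.silent_add, RamTrace.silent_add]
        exact .while_true ((htest _ s' (by omega) hI hF).2 (by omega)) he he'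
  obtain ⟨m, s', hm, he, h⟩ := key n le_rfl s (by simpa using h0) (.refl _ _)
  refine ⟨m, s', hm.trans ?_, he, h⟩
  simp only [costPoly, Polynomial.eval_mul, Polynomial.eval_add, Polynomial.eval_X,
    Polynomial.eval_one, Polynomial.eval_C, mul_add]
  gcongr
  omega

end Ensures

/-- A counting loop. -/
def forLoop (x : ℕ) (bound : RamNum) (c : RamProg) : RamProg :=
  .seq (.setNum x (.const 0) (.const 0))
    (.while (.not (.numLE bound (.load x (.const 0))))
      (.seq c (.setNum x (.const 0) (.add (.load x (.const 0)) (.const 1)))))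

/-- The bound is evaluated anew at each test, so the body may modify neither the counter nor the
arrays in the bound. The body must establish the invariant for the store in which the counter has
already been increased. -/
theorem Ensures.forLoop {Y : ℕ} {x : ℕ} {bound : RamNum} {c : RamProg} {P : RamStore K → Prop}
    {s : RamStore K} (n : ℕ) (hn : n ≤ Y) (I : ℕ → RamStore K → Prop) (hx : x ∉ c.numMods)
    (hbound : ∀ a ∈ bound.arrays, a ≠ x ∧ a ∉ c.numMods) (hval : bound.val s = n)
    (h0 : I 0 (s.setNum x 0 0))
    (hstep : ∀ k s', k < n → I k s' → (RamProg.forLoop x bound c).Frame s s' → s'.num x 0 = k →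
      Ensures Y c (fun s'' => I (k + 1) (s''.setNum x 0 (k + 1))) s')
    (hP : ∀ s', I n s' → (RamProg.forLoop x bound c).Frame s s' → P s') :
    Ensures Y (RamProg.forLoop x bound c) P s := by
  refine .seq (.setNum ?_)
  have hF0 : (RamProg.forLoop x bound c).Frame s (s.setNum x 0 0) := by
    refine ⟨fun a ha => ?_, fun a _ => rfl⟩
    simp only [RamProg.forLoop, numMods, List.mem_append, List.mem_singleton, not_or] at ha
    simp [ha.1]
  have hFt : ∀ {s'}, (.while (.not (.numLE bound (.load x (.const 0))))
      (.seq c (.setNum x (.const 0) (.add (.load x (.const 0)) (.const 1)))) : RamProg).Frame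
      (s.setNum x 0 0) s' → (RamProg.forLoop x bound c).Frame s s' := fun h =>
    hF0.trans (h.mono (by simp [RamProg.forLoop, numMods]) (by simp [RamProg.forLoop, wtMods]))
  have hb : ∀ {s'}, (RamProg.forLoop x bound c).Frame s s' → bound.val s' = n := by
    intro s' h
    rw [← hval]
    refine RamNum.val_congr _ fun a ha => h.num a ?_
    have := hbound a ha
    simp [RamProg.forLoop, numMods, this]
  refine while_iterate n hn (fun k s' => I k s' ∧ s'.num x 0 = k) ⟨h0, by simp [RamNum.val]⟩ ?_ ?_ ?_
  · rintro k s' - ⟨-, hk⟩ hF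
    simp [RamTest.Holds, hb (hFt hF), RamNum.val, hk]
  · rintro k s' hkn ⟨hI, hk⟩ hF
    refine .seq ((hstep k s' hkn hI (hFt hF) hk).mono fun s₁ hF₁ h₁ => .setNum ?_)
    have hk₁ : s₁.num x 0 = k := by rw [hF₁.num x hx, hk]
    simp only [RamNum.val, hk₁]
    exact ⟨h₁, by simp⟩
  · rintro s' ⟨hI, -⟩ hF
    exact hP s' hI (hFt hF)

end

end RamProg

/-! ## The best run under positional constraints -/

/-- `w` is the maximum of `S`, where the maximum of the empty set is `0`. -/
structure IsMaxOrZero {K : Type*} [Zero K] [LE K] (S : Set K) (w : K) : Prop where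
  le : ∀ x ∈ S, x ≤ w
  eq : w = 0 ∨ w ∈ S

namespace IsMaxOrZero

variable {K : Type*} [CommSemiring K] [LinearOrder K]

theorem empty : IsMaxOrZero (∅ : Set K) 0 := ⟨by simp, .inl rfl⟩

/-- Bipotency makes `w + w'` one of the two summands, and positivity makes it an upper bound of
both. So semiring addition is how the program computes maxima. -/
theorem union [IsOrderedRing K] (hnonneg : ∀ a : K, 0 ≤ a)
    (hbip : ∀ a b : K, a + b = a ∨ a + b = b) {S S' : Set K} {w w' : K} (h : IsMaxOrZero S w)
    (h' : IsMaxOrZero S' w') : IsMaxOrZero (S ∪ S') (w + w') := by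
  refine ⟨?_, ?_⟩
  · rintro x (hx | hx)
    · exact (h.le x hx).trans (le_add_of_nonneg_right (hnonneg _))
    · exact (h'.le x hx).trans (le_add_of_nonneg_left (hnonneg _))
  · rcases hbip w w' with e | e <;> rw [e]
    · exact h.eq.imp_right .inl
    · exact h'.eq.imp_right .inr

end IsMaxOrZero

/-- The first cell of an array. -/
abbrev RamNum.cell (a : ℕ) : RamNum := .load a (.const 0)

/-- The test whether two numbers are equal. -/
def RamTest.numEq (e e' : RamNum) : RamTest := .numLE (.add (.sub e e') (.sub e' e)) (.const 0)

-- Of the two truncated differences at least one is `0`; both are `0` exactly if the numbers agree.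
@[simp] theorem RamTest.holds_numEq {K : Type*} [CommSemiring K] [LinearOrder K] (s : RamStore K)
    (e e' : RamNum) : (RamTest.numEq e e').Holds s ↔ e.val s = e'.val s := by
  simp only [numEq, Holds, RamNum.val]
  omega

/-! ### Reading the input from the store -/

namespace WeightedVSA.Listing

section Input

variable {K α V Q : Type*} [CommSemiring K] {A : WeightedVSA K α V Q} (L : A.Listing)
  {d : List α} {s s' : RamStore K}

/-- The input is still in its place. -/
structure InputIn (d : List α) (s : RamStore K) : Prop where
  num : ∀ a < 6, s.num a = (L.input d).num a
  wt : ∀ a < 3, s.wt a = (L.input d).wt a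

variable {L}

theorem InputIn.of_frame {c : RamProg} (h : L.InputIn d s) (hF : c.Frame s s')
    (hn : ∀ a < 6, a ∉ c.numMods) (hw : ∀ a < 3, a ∉ c.wtMods) : L.InputIn d s' :=
  ⟨fun a ha => (hF.num a (hn a ha)).trans (h.num a ha),
    fun a ha => (hF.wt a (hw a ha)).trans (h.wt a ha)⟩

variable (h : L.InputIn d s)
include h

theorem InputIn.num_states : s.num 0 0 = Nat.card Q := by
  rw [h.num 0 (by norm_num)]; rfl

theorem InputIn.num_vars : s.num 0 2 = Nat.card V := by
  rw [h.num 0 (by norm_num)]; rfl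

theorem InputIn.length_doc : s.num 0 3 = d.length := by
  rw [h.num 0 (by norm_num)]; rfl

theorem InputIn.num_transitions : s.num 0 4 = L.transitions.length := by
  rw [h.num 0 (by norm_num)]; rfl

theorem InputIn.doc {i : ℕ} {a : α} (hi : d[i]? = some a) : s.num 1 i = L.letter a := by
  rw [h.num 1 (by norm_num)]
  simp [input, arrayOf, hi]

variable {t : ℕ} {p q : Q} {o : VSetLabel α V} (ht : L.transitions[t]? = some (p, o, q))
include ht

theorem InputIn.source : s.num 2 t = L.state p := by
  rw [h.num 2 (by norm_num)]
  simp [input, arrayOf, ht]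

theorem InputIn.kind : s.num 3 t = kindCode o := by
  rw [h.num 3 (by norm_num)]
  simp [input, arrayOf, ht]

theorem InputIn.arg : s.num 4 t = L.argCode o := by
  rw [h.num 4 (by norm_num)]
  simp [input, arrayOf, ht]

theorem InputIn.target : s.num 5 t = L.state q := by
  rw [h.num 5 (by norm_num)]
  simp [input, arrayOf, ht]

theorem InputIn.trans : s.wt 2 t = A.trans p o q := by
  rw [h.wt 2 (by norm_num)]
  simp [input, arrayOf, ht]

omit ht in
theorem InputIn.init (q : Q) : s.wt 0 (L.state q) = A.init q := by
  rw [h.wt 0 (by norm_num)]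
  simp [input, arrayOf]

omit ht in
theorem InputIn.final (q : Q) : s.wt 1 (L.state q) = A.final q := by
  rw [h.wt 1 (by norm_num)]
  simp [input, arrayOf]

end Input

/-! ### Paths that obey prescribed positions -/

section Paths

variable {K α V Q : Type*} [CommSemiring K] {A : WeightedVSA K α V Q} (L : A.Listing)
  (d : List α) (c : ℕ → ℕ)

/-- A transition with the given label can be used after `i` letters, if `c` prescribes the
positions of variable operations (and `0` prescribes nothing). -/
def StepOk (i : ℕ) : VSetLabel α V → Prop
  | .eps => True
  | .letter a => d[i]? = some a
  | .opening v => c (L.var v + L.var v) = 0 ∨ c (L.var v + L.var v) = i + 1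
  | .closing v => c (L.var v + L.var v + 1) = 0 ∨ c (L.var v + L.var v + 1) = i + 1

/-- The number of letters read after a transition. -/
def nextPos (i : ℕ) : VSetLabel α V → ℕ
  | .letter _ => i + 1
  | _ => i

/-- An accepting sequence of steps on the rest of the document after `i` letters, in agreement with
the prescribed positions. -/
def IsPath : ℕ → Q → List (VSetLabel α V × Q) → Prop
  | i, q, [] => A.final q ≠ 0 ∧ i = d.length
  | i, p, (o, q) :: l => A.trans p o q ≠ 0 ∧ L.StepOk d c i o ∧ IsPath (nextPos i o) q l

variable {L d c}

theorem StepOk.nextPos_le {i : ℕ} {o : VSetLabel α V} (h : L.StepOk d c i o)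
    (hi : i ≤ d.length) : nextPos i o ≤ d.length := by
  cases o with
  | letter a =>
    have := (List.getElem?_eq_some_iff.1 h).1
    simpa [nextPos]
  | _ => exact hi

theorem IsPath.le_length {l : List (VSetLabel α V × Q)} : ∀ {i : ℕ} {q : Q},
    L.IsPath d c i q l → i ≤ d.length := by
  induction l with
  | nil => intro i q h; exact h.2.le
  | cons x l ih =>
    obtain ⟨o, q'⟩ := x
    rintro i q ⟨-, -, h⟩
    refine le_trans ?_ (ih h)
    cases o <;> simp [nextPos]

end Paths

end WeightedVSA.Listing

/-! ### The dynamic program for best weights -/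

namespace RamProg

open RamNum (cell)

/-- The number of states, in the input. -/
abbrev nStates : RamNum := .load 0 (.const 0)

/-- The length of the document, in the input. -/
abbrev docLength : RamNum := .load 0 (.const 3)

/-- The number of transitions, in the input. -/
abbrev nTransitions : RamNum := .load 0 (.const 4)

/-- Improve the table of best weights (semiring array `3`) at the row that starts at the entry of
array `33`, by means of the transition with the number in array `35`. -/
def relaxTo (shift : RamNum) : RamProg :=
  .setWt 3 (.add (cell 33) (.load 2 (cell 35)))
    (.add (.load 3 (.add (cell 33) (.load 2 (cell 35))))
      (.mul (.load 2 (cell 35)) (.load 3 (.add (.add (cell 33) shift) (.load 5 (cell 35))))))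

/-- Improve the table if the position prescribed in array `10` is the one in array `34`. -/
def relaxIfAllowed (e : RamNum) : RamProg :=
  .ite (.numLE (.load 10 e) (.const 0)) (relaxTo (.const 0))
    (.ite (.numEq (.load 10 e) (.add (cell 34) (.const 1))) (relaxTo (.const 0)) .skip)

/-- Improve the table by means of a transition, if it can be used. -/
def relax : RamProg :=
  .ite (.numLE (.load 3 (cell 35)) (.const 0)) (relaxTo (.const 0))
    (.ite (.numLE (.load 3 (cell 35)) (.const 1))
      (.ite (.numLE docLength (cell 34)) .skip
        (.ite (.numEq (.load 1 (cell 34)) (.load 4 (cell 35))) (relaxTo nStates) .skip))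
      (.ite (.numLE (.load 3 (cell 35)) (.const 2))
        (relaxIfAllowed (.add (.load 4 (cell 35)) (.load 4 (cell 35))))
        (relaxIfAllowed (.add (.add (.load 4 (cell 35)) (.load 4 (cell 35))) (.const 1)))))

/-- Improve the table by means of all transitions at all positions. -/
def relaxAll : RamProg :=
  .seq (.setNum 33 (.const 0) (.const 0))
    (forLoop 34 (.add docLength (.const 1))
      (.seq (forLoop 35 nTransitions relax)
        (.setNum 33 (.const 0) (.add (cell 33) nStates))))

/-- Put the best weight of a run with the positions prescribed in array `10` into semiring array
`5`. Array `20` holds the start of the last row of the table, array `21` a bound on the size of the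
table and the length of runs. -/
def bestRun : RamProg :=
  .seq (forLoop 31 (cell 21) (.setWt 3 (cell 31) .zero))
    (.seq (forLoop 31 nStates (.setWt 3 (.add (cell 20) (cell 31)) (.load 1 (cell 31))))
      (.seq (forLoop 32 (cell 21) relaxAll)
        (.seq (.setWt 5 (.const 0) .zero)
          (forLoop 31 nStates (.setWt 5 (.const 0)
            (.add (.load 5 (.const 0)) (.mul (.load 0 (cell 31)) (.load 3 (cell 31)))))))))

end RamProg

namespace WeightedVSA.Listing

open RamProg

variable {K α V Q : Type*} [CommSemiring K] [LinearOrder K] {A : WeightedVSA K α V Q}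
  {L : A.Listing} {d : List α} {s : RamStore K} {Y : ℕ}

variable (L) in
/-- The entry of the table of best weights for a position and a state. -/
noncomputable def table (s : RamStore K) (i : ℕ) (q : Q) : K := s.wt 3 (i * Nat.card Q + L.state q)

-- State numbers are below `Nat.card Q`, so quotient and remainder recover the position and the
-- state from the index: distinct entries lie in distinct cells.
omit [LinearOrder K] in
theorem table_setWt (s : RamStore K) (i i' : ℕ) (q q' : Q) (w : K) [Decidable (i' = i ∧ q' = q)] :
    L.table (s.setWt 3 (i * Nat.card Q + L.state q) w) i' q' =
      if i' = i ∧ q' = q then w else L.table s i' q' := by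
  have key : i' * Nat.card Q + L.state q' = i * Nat.card Q + L.state q ↔ i' = i ∧ q' = q := by
    refine ⟨fun h => ?_, fun h => by rw [h.1, h.2]⟩
    have hq := (L.state q).2
    have hq' := (L.state q').2
    have h1 := congrArg (· / Nat.card Q) h
    simp only [Nat.add_div_of_dvd_right (Dvd.intro_left _ rfl),
      Nat.mul_div_cancel _ (Nat.zero_lt_of_lt hq), Nat.div_eq_of_lt hq, Nat.div_eq_of_lt hq'] at h1
    have h1 : i' = i := by simpa using h1
    subst h1
    exact ⟨rfl, L.state.injective (Fin.ext (by omega))⟩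
  simp only [table, RamStore.setWt_wt_self, Function.update_apply, key]

variable (L) in
/-- The improvement of a table by means of one transition. -/
noncomputable def relaxed (d : List α) (c : ℕ → ℕ) (M : ℕ → Q → K) (i : ℕ)
    (x : Q × VSetLabel α V × Q) (i' : ℕ) (q' : Q) : K :=
  open Classical in
  if L.StepOk d c i x.2.1 ∧ i' = i ∧ q' = x.1 then
    M i x.1 + A.trans x.1 x.2.1 x.2.2 * M (nextPos i x.2.1) x.2.2 else M i' q'

theorem ensures_relax (h : L.InputIn d s) {i t : ℕ} {x : Q × VSetLabel α V × Q}
    (ht : L.transitions[t]? = some x) (hs33 : s.num 33 0 = i * Nat.card Q)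
    (hs34 : s.num 34 0 = i) (hs35 : s.num 35 0 = t) :
    Ensures Y relax (fun s' => L.table s' = L.relaxed d (s.num 10) (L.table s) i x) s := by
  classical
  subst hs35
  obtain ⟨p, o, q⟩ := x
  have hskip : ¬ L.StepOk d (s.num 10) i o → Ensures Y .skip
      (fun s' => L.table s' = L.relaxed d (s.num 10) (L.table s) i (p, o, q)) s := by
    intro hno
    refine .skip ?_
    funext i' q'
    simp [relaxed, hno]
  have hto : ∀ e : RamNum, i * Nat.card Q + e.val s = nextPos i o * Nat.card Q →
      L.StepOk d (s.num 10) i o → Ensures Y (relaxTo e)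
      (fun s' => L.table s' = L.relaxed d (s.num 10) (L.table s) i (p, o, q)) s := by
    intro e he hok
    refine .setWt ?_
    funext i' q'
    simp only [RamNum.val, RamWt.val, hs33, h.source ht, h.target ht, h.trans ht, he,
      table_setWt, relaxed, hok, true_and]
    rfl
  have harg := h.arg ht
  have hkind := h.kind ht
  have hallow : ∀ e : RamNum, nextPos i o = i →
      (L.StepOk d (s.num 10) i o ↔ s.num 10 (e.val s) = 0 ∨ s.num 10 (e.val s) = i + 1) →
      Ensures Y (relaxIfAllowed e)
      (fun s' => L.table s' = L.relaxed d (s.num 10) (L.table s) i (p, o, q)) s := by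
    intro e he hok
    refine .ite (fun h1 => hto _ (by simp [RamNum.val, he]) ?_) fun h1 =>
      .ite (fun h2 => hto _ (by simp [RamNum.val, he]) ?_) fun h2 => hskip ?_
    · simp only [RamTest.Holds, RamNum.val, Nat.le_zero] at h1
      exact hok.2 (.inl h1)
    · simp only [RamTest.holds_numEq, RamNum.val, hs34] at h2
      exact hok.2 (.inr h2)
    · simp only [RamTest.Holds, RamTest.holds_numEq, RamNum.val, hs34, Nat.le_zero] at h1 h2
      rw [hok]
      tauto
  -- The program branches on the kind code. Of all pairs of a branch and a constructor six are
  -- consistent: `ε`, a letter after the end of the document, a matching letter, another letter, an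
  -- opening, a closing.
  refine .ite (fun h1 => ?_) fun h1 => .ite (fun h2 => .ite (fun h3 => ?_) fun h3 =>
    .ite (fun h4 => ?_) fun h4 => ?_) fun h2 => .ite (fun h3 => ?_) fun h3 => ?_ <;>
  cases o <;>
  simp only [RamTest.Holds, RamTest.holds_numEq, RamNum.val, hs34, hkind, kindCode,
    h.length_doc, harg, argCode] at * <;> (try omega)
  · exact hto _ (by simp [RamNum.val, nextPos]) trivial
  · rename_i a
    refine hskip ?_
    rw [StepOk, List.getElem?_eq_none h3]
    simp
  · rename_i a
    refine hto _ (by simp [RamNum.val, nextPos, h.num_states, add_mul]) ?_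
    have h5 : d[i]? = some d[i] := List.getElem?_eq_getElem (by omega)
    rw [h.doc h5, Fin.val_inj, L.letter.injective.eq_iff] at h4
    rw [StepOk, h5, h4]
  · rename_i a
    refine hskip fun h5 => h4 ?_
    rw [h.doc h5]
  · exact hallow _ rfl (by simp [RamNum.val, h.arg ht, argCode, StepOk])
  · exact hallow _ rfl (by simp [RamNum.val, h.arg ht, argCode, StepOk])

end WeightedVSA.Listing

namespace WeightedVSA.Listing

open RamProg

variable {K α V Q : Type*} [CommSemiring K] [LinearOrder K] {A : WeightedVSA K α V Q}
  {L : A.Listing} {d : List α} {s : RamStore K} {Y : ℕ}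

omit [LinearOrder K] in
@[simp] theorem table_setNum (s : RamStore K) (a i v : ℕ) :
    L.table (s.setNum a i v) = L.table s := rfl

variable (L) in
/-- The entries of the table are weights of paths. -/
def SoundTable (d : List α) (c : ℕ → ℕ) (M : ℕ → Q → K) : Prop :=
  ∀ i q, i ≤ d.length → M i q = 0 ∨ ∃ l, L.IsPath d c i q l ∧ A.weightFrom q l = M i q

variable (L) in
/-- The entries of the table are at least the weights of the paths with at most `k` steps. -/
def CompleteTable (d : List α) (c : ℕ → ℕ) (k : ℕ) (M : ℕ → Q → K) : Prop :=
  ∀ i q l, L.IsPath d c i q l → l.length ≤ k → A.weightFrom q l ≤ M i q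

variable {c : ℕ → ℕ} {M M₀ : ℕ → Q → K} {i : ℕ} {x : Q × VSetLabel α V × Q}

-- By bipotency the new entry is either the old one or comes from putting the transition in front of
-- a path. This argument does not depend on the order of the updates, so the table can be updated in
-- place.
omit [LinearOrder K] in
theorem SoundTable.relaxed (hbip : ∀ a b : K, a + b = a ∨ a + b = b) (h : L.SoundTable d c M)
    (hx : x ∈ L.transitions) : L.SoundTable d c (L.relaxed d c M i x) := by
  intro i' q' hi'
  obtain ⟨p, o, q⟩ := x
  rw [Listing.relaxed]
  split_ifs with hc
  · obtain ⟨hok, rfl, rfl⟩ := hc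
    rcases hbip (M i' q') (A.trans q' o q * M (nextPos i' o) q) with e | e <;> simp only [e]
    · exact h i' q' hi'
    · rcases h _ q (hok.nextPos_le hi') with h0 | ⟨l, hl, hw⟩
      · left
        simp [h0]
      · exact .inr ⟨(o, q) :: l, ⟨(L.mem_iff _ _ _).1 hx, hok, hl⟩, by rw [weightFrom, hw]⟩
  · exact h i' q' hi'

theorem le_relaxed [IsOrderedRing K] (hnonneg : ∀ a : K, 0 ≤ a) (i' : ℕ) (q' : Q) :
    M i' q' ≤ L.relaxed d c M i x i' q' := by
  rw [Listing.relaxed]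
  split_ifs with hc
  · obtain ⟨hok, rfl, rfl⟩ := hc
    exact le_add_of_nonneg_right (hnonneg _)
  · exact le_rfl

theorem mul_le_relaxed [IsOrderedRing K] (hnonneg : ∀ a : K, 0 ≤ a)
    (hM : ∀ i q, M₀ i q ≤ M i q) (hok : L.StepOk d c i x.2.1) :
    A.trans x.1 x.2.1 x.2.2 * M₀ (nextPos i x.2.1) x.2.2 ≤ L.relaxed d c M i x i x.1 := by
  rw [Listing.relaxed, if_pos ⟨hok, rfl, rfl⟩]
  exact (mul_le_mul_of_nonneg_left (hM _ _) (hnonneg _)).trans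
    (le_add_of_nonneg_left (hnonneg _))

/-- A path with `k + 1` steps is a transition followed by a path with `k` steps, whose weight the
old table `M₀` already dominates. Only lower bounds on the new table `M` are needed, so updates
within the same round do no harm. -/
theorem CompleteTable.succ [IsOrderedRing K] (hnonneg : ∀ a : K, 0 ≤ a) {k : ℕ}
    (h : L.CompleteTable d c k M₀) (hM : ∀ i q, M₀ i q ≤ M i q)
    (hx : ∀ i ≤ d.length, ∀ x ∈ L.transitions, L.StepOk d c i x.2.1 →
      A.trans x.1 x.2.1 x.2.2 * M₀ (nextPos i x.2.1) x.2.2 ≤ M i x.1) :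
    L.CompleteTable d c (k + 1) M := by
  intro i q l hl hk
  cases l with
  | nil => exact (h i q [] hl (by simp)).trans (hM i q)
  | cons y l =>
    obtain ⟨o, q'⟩ := y
    refine le_trans ?_ (hx i hl.le_length (q, o, q') ((L.mem_iff _ _ _).2 hl.1) hl.2.1)
    exact mul_le_mul_of_nonneg_left (h _ _ _ hl.2.2 (by simpa using hk)) (hnonneg _)

variable [IsOrderedRing K] (hnonneg : ∀ a : K, 0 ≤ a) (hbip : ∀ a b : K, a + b = a ∨ a + b = b)
include hnonneg hbip

theorem ensures_relaxAll (h : L.InputIn d s) (hd : d.length + 1 ≤ Y)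
    (ht : L.transitions.length ≤ Y) {k : ℕ} (hS : L.SoundTable d (s.num 10) (L.table s))
    (hC : L.CompleteTable d (s.num 10) k (L.table s)) :
    Ensures Y relaxAll (fun s' => L.SoundTable d (s.num 10) (L.table s') ∧
      L.CompleteTable d (s.num 10) (k + 1) (L.table s')) s := by
  set c := s.num 10 with hc
  set M₀ := L.table s with hM₀
  -- After `i` positions: the table is sound, it has not fallen below its contents `M₀` at the start
  -- of the round, and at the earlier positions every usable transition has been taken into account
  -- with respect to `M₀`.
  let J : ℕ → RamStore K → Prop := fun i s' => L.SoundTable d c (L.table s') ∧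
    (∀ i q, M₀ i q ≤ L.table s' i q) ∧ s'.num 33 0 = i * Nat.card Q ∧
    ∀ i' < i, ∀ x ∈ L.transitions, L.StepOk d c i' x.2.1 →
      A.trans x.1 x.2.1 x.2.2 * M₀ (nextPos i' x.2.1) x.2.2 ≤ L.table s' i' x.1
  have hJ : ∀ i (s' : RamStore K) v, J i s' → J i (s'.setNum 34 0 v) := by
    intro i s' v h
    simpa [J] using h
  refine .seq (.setNum (.forLoop (d.length + 1) hd J (by decide) (by decide) ?_ ?_ ?_ ?_))
  · simp [RamNum.val, h.length_doc]
  · refine hJ _ _ _ ⟨?_, ?_, ?_, ?_⟩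
    · exact hS
    · exact fun i q => le_rfl
    · simp [RamNum.val]
    · simp
  · intro i s₁ hi hJ₁ hF hs34
    have hI₁ : L.InputIn d s₁ := (h.of_frame (c := .setNum 33 (.const 0) (.const 0))
      (Exec.setNum ..).frame (by decide) (by decide)).of_frame hF (by decide) (by decide)
    have hc₁ : s₁.num 10 = c := by
      rw [hF.num 10 (by decide)]
      simp [hc]
    refine .seq (.forLoop L.transitions.length ht
      (fun t s' => J i s' ∧ ∀ t' < t, ∀ x, L.transitions[t']? = some x → L.StepOk d c i x.2.1 →
        A.trans x.1 x.2.1 x.2.2 * M₀ (nextPos i x.2.1) x.2.2 ≤ L.table s' i x.1)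
      (by decide) (by decide) ?_ ?_ ?_ ?_)
    · simp [RamNum.val, hI₁.num_transitions]
    · exact ⟨by simpa [J] using hJ₁, by simp⟩
    · intro t s₂ htn hJ₂ hF₂ hs35
      have hI₂ : L.InputIn d s₂ := hI₁.of_frame hF₂ (by decide) (by decide)
      have hc₂ : s₂.num 10 = c := by rw [hF₂.num 10 (by decide), hc₁]
      have hx := List.getElem?_eq_getElem htn
      set x := L.transitions[t]
      have hs34' : s₂.num 34 0 = i := by rw [hF₂.num 34 (by decide), hs34]
      refine (ensures_relax hI₂ hx hJ₂.1.2.2.1 hs34' hs35).mono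
        fun s₃ hF₃ htab => ?_
      rw [hc₂] at htab
      have hs33 : s₃.num 33 0 = i * Nat.card Q := by
        rw [hF₃.num 33 (by decide), hJ₂.1.2.2.1]
      have htab' : L.table (s₃.setNum 35 0 (t + 1)) = L.table s₃ := rfl
      have hle : ∀ i q, L.table s₂ i q ≤ L.table s₃ i q := by
        rw [htab]
        exact fun i q => le_relaxed hnonneg i q
      refine ⟨⟨?_, ?_, by simpa using hs33, ?_⟩, ?_⟩ <;> simp only [htab']
      · rw [htab]
        exact hJ₂.1.1.relaxed hbip (List.mem_of_getElem? hx)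
      · exact fun i q => (hJ₂.1.2.1 i q).trans (hle i q)
      · exact fun i' hi' x hx hok => (hJ₂.1.2.2.2 i' hi' x hx hok).trans (hle _ _)
      · intro t' ht' y hy hok
        rcases Nat.lt_succ_iff_lt_or_eq.1 ht' with h1 | rfl
        · exact (hJ₂.2 t' h1 y hy hok).trans (hle _ _)
        · rw [hx, Option.some_inj] at hy
          subst hy
          rw [htab]
          exact mul_le_relaxed hnonneg hJ₂.1.2.1 hok
    · rintro s₂ ⟨hJ₂, hx⟩ hF₂
      have hI₂ : L.InputIn d s₂ := hI₁.of_frame hF₂ (by decide) (by decide)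
      refine .setNum (hJ _ _ _ ⟨hJ₂.1, hJ₂.2.1, ?_, ?_⟩)
      · simp [RamNum.val, hJ₂.2.2.1, hI₂.num_states, add_mul]
      · intro i' hi' x hx' hok
        rcases Nat.lt_succ_iff_lt_or_eq.1 hi' with h1 | rfl
        · exact hJ₂.2.2.2 i' h1 x hx' hok
        · obtain ⟨t, ht, rfl⟩ := List.getElem_of_mem hx'
          exact hx t ht _ (List.getElem?_eq_getElem ht) hok
  · rintro s₁ hJ₁ -
    exact ⟨hJ₁.1, hC.succ hnonneg hJ₁.2.1
      fun i hi x hx hok => hJ₁.2.2.2 i (by omega) x hx hok⟩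

/-- After `N` rounds the table dominates all paths with at most `N` steps. By `hlen` these include
all paths from initial states, and row `0` then yields the optimum. -/
theorem ensures_bestRun {N : ℕ} (h : L.InputIn d s) (hs20 : s.num 20 0 = d.length * Nat.card Q)
    (hs21 : s.num 21 0 = N) (hN : (d.length + 1) * Nat.card Q ≤ N) (hNY : N ≤ Y)
    (hQ : Nat.card Q ≤ Y) (hd : d.length + 1 ≤ Y) (ht : L.transitions.length ≤ Y)
    (hlen : ∀ q l, A.init q ≠ 0 → L.IsPath d (s.num 10) 0 q l → l.length ≤ N) :
    Ensures Y bestRun (fun s' => IsMaxOrZero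
      {w | ∃ q l, L.IsPath d (s.num 10) 0 q l ∧ A.init q * A.weightFrom q l = w} (s'.wt 5 0)) s := by
  set c := s.num 10 with hc
  -- The table may hold values from an earlier call. Clearing `N` cells clears all of it, because
  -- `N` is at least the size of the table.
  refine .seq (.forLoop N hNY (fun k s' => ∀ j < k, s'.wt 3 j = 0) (by decide) (by decide)
    (by simp [RamNum.val, hs21]) (by simp) ?_ ?_)
  · intro k s₁ hk h0 hF hs31
    refine .setWt fun j hj => ?_
    simp only [RamNum.val, hs31, RamWt.val, RamStore.setNum_wt, RamStore.setWt_wt_self,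
      Function.update_apply]
    split_ifs
    · rfl
    · exact h0 j (by omega)
  intro s₁ h0 hF₁
  have hI₁ : L.InputIn d s₁ := h.of_frame hF₁ (by decide) (by decide)
  have hc₁ : s₁.num 10 = c := hF₁.num 10 (by decide)
  have hs20₁ : s₁.num 20 0 = d.length * Nat.card Q := by rw [hF₁.num 20 (by decide), hs20]
  have hs21₁ : s₁.num 21 0 = N := by rw [hF₁.num 21 (by decide), hs21]
  refine .seq (.forLoop (Nat.card Q) hQ (fun k s' => (∀ j < d.length * Nat.card Q, s'.wt 3 j = 0) ∧
    ∀ j < k, s'.wt 3 (d.length * Nat.card Q + j) = s₁.wt 1 j) (by decide) (by decide)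
    (by simp [RamNum.val, hI₁.num_states]) ⟨?_, by simp⟩ ?_ ?_)
  · intro j hj
    exact h0 j (by rw [add_mul] at hN; omega)
  · rintro k s₂ hk ⟨hz, hf⟩ hF hs31
    refine .setWt ⟨fun j hj => ?_, fun j hj => ?_⟩ <;>
    simp only [RamNum.val, hs31, RamWt.val, RamStore.setNum_wt, RamStore.setWt_wt_self,
      Function.update_apply, hF.num 20 (by decide), hs20₁, hF.wt 1 (by decide)] <;> split_ifs
    · omega
    · exact hz j hj
    · rw [show j = k by omega]
    · exact hf j (by omega)
  rintro s₂ ⟨hz, hf⟩ hF₂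
  have hI₂ : L.InputIn d s₂ := hI₁.of_frame hF₂ (by decide) (by decide)
  have hc₂ : s₂.num 10 = c := by rw [hF₂.num 10 (by decide), hc₁]
  have hs21₂ : s₂.num 21 0 = N := by rw [hF₂.num 21 (by decide), hs21₁]
  have hfin : ∀ q, L.table s₂ d.length q = A.final q := fun q => by
    rw [table, hf _ (L.state q).2, hI₁.final]
  refine .seq (.forLoop N hNY (fun k s' => L.SoundTable d c (L.table s') ∧
    L.CompleteTable d c k (L.table s')) (by decide) (by decide)
    (by simp [RamNum.val, hs21₂]) ?_ ?_ ?_)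
  · refine ⟨fun i q hi => ?_, fun i q l hl hk => ?_⟩ <;> rw [table_setNum]
    · rcases hi.lt_or_eq with hi | rfl
      · left
        refine hz _ ?_
        have := (L.state q).2
        calc i * Nat.card Q + L.state q < (i + 1) * Nat.card Q := by rw [add_mul]; omega
          _ ≤ _ := Nat.mul_le_mul_right _ hi
      · rw [hfin]
        by_cases h0 : A.final q = 0
        · exact .inl h0
        · exact .inr ⟨[], ⟨h0, rfl⟩, rfl⟩
    · obtain rfl : l = [] := by simpa using hk
      rw [hl.2, hfin]
      exact le_rfl
  · rintro k s₃ hk ⟨hS, hC⟩ hF hs32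
    have hI : L.InputIn d s₃ := hI₂.of_frame hF (by decide) (by decide)
    have hc₃ : s₃.num 10 = c := by rw [hF.num 10 (by decide), hc₂]
    rw [← hc₃] at hS hC ⊢
    exact ensures_relaxAll hnonneg hbip hI hd ht hS hC
  rintro s₃ ⟨hS, hC⟩ hF₃
  have hI₃ : L.InputIn d s₃ := hI₂.of_frame hF₃ (by decide) (by decide)
  refine .seq (.setWt (.forLoop (Nat.card Q) hQ (fun k s' => IsMaxOrZero
    {w | ∃ q l, L.state q < k ∧ L.IsPath d c 0 q l ∧ A.init q * A.weightFrom q l = w} (s'.wt 5 0))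
    (by decide) (by decide) (by simp [RamNum.val, hI₃.num_states]) ?_ ?_ ?_))
  · simpa [RamNum.val, RamWt.val] using IsMaxOrZero.empty
  · intro k s₄ hk hM hF hs31
    have hI₄ : L.InputIn d s₄ := (hI₃.of_frame (c := .setWt 5 (.const 0) .zero)
      (Exec.setWt ..).frame (by decide) (by decide)).of_frame hF (by decide) (by decide)
    obtain ⟨q, hq⟩ := L.state.surjective ⟨k, hk⟩
    have hq : (L.state q : ℕ) = k := by rw [hq]
    have htab : s₄.wt 3 (L.state q) = L.table s₃ 0 q := by
      rw [hF.wt 3 (by decide), table, zero_mul, zero_add]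
      simp
    refine .setWt ?_
    simp only [RamNum.val, hs31, RamWt.val, RamStore.setNum_wt, RamStore.setWt_wt_self,
      Function.update_self, ← hq, htab, hI₄.init]
    have hM' : IsMaxOrZero {w | ∃ l, L.IsPath d c 0 q l ∧ A.init q * A.weightFrom q l = w}
        (A.init q * L.table s₃ 0 q) := by
      refine ⟨?_, ?_⟩
      · rintro _ ⟨l, hl, rfl⟩
        -- The length bound `hlen` is available only for paths from initial states; at the other
        -- states the factor `A.init q` vanishes.
        by_cases h0 : A.init q = 0
        · simp [h0]
        · exact mul_le_mul_of_nonneg_left (hC 0 q l hl (hlen q l h0 hl)) (hnonneg _)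
      · rcases hS 0 q (Nat.zero_le _) with h0 | ⟨l, hl, hw⟩
        · simp [h0]
        · exact .inr ⟨l, hl, by rw [hw]⟩
    convert hM.union hnonneg hbip hM' using 1
    ext w
    simp only [Set.mem_ofPred_eq, Set.mem_union]
    constructor
    · rintro ⟨q', l, hq', hl, hw⟩
      rcases Nat.lt_succ_iff_lt_or_eq.1 hq' with h1 | h1
      · exact .inl ⟨q', l, by omega, hl, hw⟩
      · obtain rfl := L.state.injective (Fin.ext h1)
        exact .inr ⟨l, hl, hw⟩
    · rintro (⟨q', l, hq', hl, hw⟩ | ⟨l, hl, hw⟩)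
      · exact ⟨q', l, by omega, hl, hw⟩
      · exact ⟨q, l, by omega, hl, hw⟩
  · intro s₄ hM hF
    convert hM using 1
    ext w
    simp

end WeightedVSA.Listing

/-! ## The tree of prefixes of answers -/

/-- `π` consists of at most `D` numbers between `1` and `B`. -/
def IsBoundedWord (B D : ℕ) (π : List ℕ) : Prop := π.length ≤ D ∧ ∀ x ∈ π, 0 < x ∧ x ≤ B

theorem IsBoundedWord.snoc {B D p : ℕ} {π : List ℕ} (h : IsBoundedWord B D π) (hπ : π.length < D)
    (hp : p < B) : IsBoundedWord B D (π ++ [p + 1]) := by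
  refine ⟨by simpa using hπ, fun x hx => ?_⟩
  rw [List.mem_append, List.mem_singleton] at hx
  rcases hx with hx | rfl
  · exact h.2 x hx
  · omega

/-- The weights of the words that continue `π` and are not in `out`. -/
def wordWeights {K : Type*} (B D : ℕ) (f : List ℕ → K) (out : Set (List ℕ)) (π : List ℕ) : Set K :=
  {w | ∃ u, IsBoundedWord B D u ∧ u.length = D ∧ u ∉ out ∧ π <+: u ∧ f u = w}

section

variable {K : Type*} {B D : ℕ} {f : List ℕ → K} {out : Set (List ℕ)} {π : List ℕ}

theorem wordWeights_eq_iUnion (hπ : π.length < D) :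
    wordWeights B D f out π = {w | ∃ p < B, w ∈ wordWeights B D f out (π ++ [p + 1])} := by
  ext w
  constructor
  · rintro ⟨u, hu, hD, ho, ⟨v, rfl⟩, rfl⟩
    cases v with
    | nil => simp at hD; omega
    | cons x v =>
      obtain ⟨h0, hB⟩ := hu.2 x (by simp)
      exact ⟨x - 1, by omega, _, hu, hD, ho, ⟨v, by simp [Nat.sub_add_cancel h0]⟩, rfl⟩
  · rintro ⟨p, -, u, hu, hD, ho, hp, rfl⟩
    exact ⟨u, hu, hD, ho, (List.prefix_append ..).trans hp, rfl⟩

/-- Only the excluded words below `π` matter. This allows `out` to be replaced by `∅` below a node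
without children, and a new answer to be ignored off its path. -/
theorem wordWeights_congr {out' : Set (List ℕ)} (h : ∀ u, π <+: u → (u ∈ out ↔ u ∈ out')) :
    wordWeights B D f out π = wordWeights B D f out' π := by
  ext w
  constructor <;> rintro ⟨u, hu, hD, ho, hp, rfl⟩
  · exact ⟨u, hu, hD, fun h' => ho ((h u hp).2 h'), hp, rfl⟩
  · exact ⟨u, hu, hD, fun h' => ho ((h u hp).1 h'), hp, rfl⟩

end

/-- The nodes `n < top` of a tree stand for the words `π n`. The children of an inner node `n` have
consecutive numbers from `ch n` on. The nodes without children have no proper continuation in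
`out`. -/
structure IsPrefixTree (B D : ℕ) (out : Set (List ℕ)) (ch : ℕ → ℕ) (top : ℕ) (π : ℕ → List ℕ) :
    Prop where
  top_pos : 0 < top
  root : π 0 = []
  bounded : ∀ n < top, IsBoundedWord B D (π n)
  inj : ∀ n < top, ∀ m < top, π n = π m → n = m
  child : ∀ n < top, ch n ≠ 0 → ∀ p < B, ch n + p < top ∧ π (ch n + p) = π n ++ [p + 1]
  parent : ∀ n < top, n ≠ 0 → ∃ m < top, ch m ≠ 0 ∧ ∃ p < B, n = ch m + p
  fresh : ∀ n, top ≤ n → ch n = 0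
  leaf : ∀ n < top, ch n = 0 → (π n).length < D → ∀ u ∈ out, ¬ π n <+: u

namespace IsPrefixTree

variable {B D : ℕ} {out : Set (List ℕ)} {ch : ℕ → ℕ} {top : ℕ} {π : ℕ → List ℕ}

/-- The words of the nodes after an expansion. -/
def expandWords (top : ℕ) (π : ℕ → List ℕ) (v n : ℕ) : List ℕ :=
  if n < top then π n else π v ++ [n - top + 1]

theorem expandWords_of_lt {v n : ℕ} (h : n < top) : expandWords top π v n = π n := if_pos h

@[simp] theorem expandWords_top_add {v p : ℕ} :
    expandWords top π v (top + p) = π v ++ [p + 1] := by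
  simp [expandWords]

/-- The value `0` of `ch` can stand for the absence of children because the block of children starts
at `top > 0`. The new nodes have no children by `fresh`, and no word of `out` extends them since
none extends `π v`. -/
theorem expand (h : IsPrefixTree B D out ch top π) (hB : 0 < B) {v : ℕ} (hv : v < top)
    (hch : ch v = 0) (hlen : (π v).length < D) :
    IsPrefixTree B D out (Function.update ch v top) (top + B) (expandWords top π v) := by
  have cases_lt : ∀ {n}, n < top + B → n < top ∨ ∃ p < B, n = top + p := by
    intro n hn
    rcases lt_or_ge n top with h1 | h1
    · exact .inl h1
    · exact .inr ⟨n - top, by omega, by omega⟩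
  -- The new words are new: a node with such a word would be a child of a node with the word `π v`,
  -- which is `v` by injectivity, but `v` has no children.
  have key : ∀ n < top, ∀ p, π n ≠ π v ++ [p + 1] := by
    intro n hn p he
    obtain ⟨m, hm, hmc, p', hp', rfl⟩ := h.parent n hn (by
      rintro rfl
      rw [h.root] at he
      simp at he)
    rw [(h.child m hm hmc p' hp').2] at he
    have := h.inj m hm v hv (List.append_inj_left' he rfl)
    exact hmc (this ▸ hch)
  have htop := h.top_pos
  refine ⟨by omega, ?_, ?_, ?_, ?_, ?_, ?_, ?_⟩
  · rw [expandWords_of_lt htop, h.root]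
  · intro n hn
    rcases cases_lt hn with hn | ⟨p, hp, rfl⟩
    · rw [expandWords_of_lt hn]
      exact h.bounded n hn
    · rw [expandWords_top_add]
      exact (h.bounded v hv).snoc hlen hp
  · intro n hn m hm
    rcases cases_lt hn with hn | ⟨p, hp, rfl⟩ <;> rcases cases_lt hm with hm | ⟨p', hp', rfl⟩
    · rw [expandWords_of_lt hn, expandWords_of_lt hm]
      exact h.inj n hn m hm
    · rw [expandWords_of_lt hn, expandWords_top_add]
      exact fun he => absurd he (key n hn p')
    · rw [expandWords_of_lt hm, expandWords_top_add]
      exact fun he => absurd he.symm (key m hm p)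
    · rw [expandWords_top_add, expandWords_top_add]
      intro he
      have := List.append_inj_right' he rfl
      simp at this
      omega
  · intro n hn hc p hp
    rcases cases_lt hn with hn | ⟨p', hp', rfl⟩
    · rcases eq_or_ne n v with rfl | hne
      · simp only [Function.update_self, expandWords_top_add, expandWords_of_lt hn, and_true]
        omega
      · rw [Function.update_of_ne hne] at hc ⊢
        obtain ⟨h1, h2⟩ := h.child n hn hc p hp
        rw [expandWords_of_lt h1, expandWords_of_lt hn]
        exact ⟨by omega, h2⟩
    · rw [Function.update_of_ne (by omega), h.fresh _ (by omega)] at hc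
      exact absurd rfl hc
  · intro n hn h0
    rcases cases_lt hn with hn | ⟨p, hp, rfl⟩
    · obtain ⟨m, hm, hmc, p, hp, rfl⟩ := h.parent n hn h0
      have hne : m ≠ v := by
        rintro rfl
        exact hmc hch
      exact ⟨m, by omega, by rwa [Function.update_of_ne hne], p, hp, by
        rw [Function.update_of_ne hne]⟩
    · exact ⟨v, by omega, by rw [Function.update_self]; omega, p, hp, by rw [Function.update_self]⟩
  · intro n hn
    rw [Function.update_of_ne (by omega), h.fresh n (by omega)]
  · intro n hn hc hl u hu hp
    rcases cases_lt hn with hn | ⟨p, hp', rfl⟩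
    · rw [expandWords_of_lt hn] at hl hp
      rcases eq_or_ne n v with rfl | hne
      · rw [Function.update_self] at hc
        omega
      · rw [Function.update_of_ne hne] at hc
        exact h.leaf n hn hc hl u hu hp
    · rw [expandWords_top_add] at hp
      exact h.leaf v hv hch hlen u hu ((List.prefix_append ..).trans hp)

end IsPrefixTree

/-- The values `R` of the nodes of a tree are the best weights of continuations outside `out`. -/
structure IsWeightedTree {K : Type*} [Zero K] [LE K] (B D : ℕ) (f : List ℕ → K)
    (out : Set (List ℕ)) (ch : ℕ → ℕ) (top : ℕ) (R : ℕ → K) (π : ℕ → List ℕ) : Prop extends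
    IsPrefixTree B D out ch top π where
  value : ∀ n < top, IsMaxOrZero (wordWeights B D f out (π n)) (R n)

/-- The values of the new nodes may be computed without regard to `out`: by `leaf`, no word of `out`
lies below `v`. -/
theorem IsWeightedTree.expand {K : Type*} [Zero K] [LE K] {B D : ℕ} {f : List ℕ → K}
    {out : Set (List ℕ)} {ch : ℕ → ℕ} {top : ℕ} {R R' : ℕ → K} {π : ℕ → List ℕ}
    (h : IsWeightedTree B D f out ch top R π) (hB : 0 < B) {v : ℕ} (hv : v < top)
    (hch : ch v = 0) (hlen : (π v).length < D) (hR : ∀ n < top, R' n = R n)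
    (hR' : ∀ p < B, IsMaxOrZero (wordWeights B D f ∅ (π v ++ [p + 1])) (R' (top + p))) :
    IsWeightedTree B D f out (Function.update ch v top) (top + B) R'
      (IsPrefixTree.expandWords top π v) where
  toIsPrefixTree := h.toIsPrefixTree.expand hB hv hch hlen
  value n hn := by
    rcases lt_or_ge n top with h1 | h1
    · rw [IsPrefixTree.expandWords_of_lt h1, hR n h1]
      exact h.value n h1
    · obtain ⟨p, rfl⟩ := Nat.exists_eq_add_of_le h1
      rw [IsPrefixTree.expandWords_top_add, wordWeights_congr (out' := ∅)]
      · exact hR' p (by omega)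
      · intro u hu
        simp only [Set.mem_empty_iff_false, iff_false]
        exact fun hu' => h.leaf v hv hch hlen u hu' ((List.prefix_append ..).trans hu)

/-! ### Descending to a best answer -/

namespace RamProg

open RamNum (cell)

/-- The length of the answers, in terms of the input. -/
abbrev answerLength : RamNum := .add (.load 0 (.const 2)) (.load 0 (.const 2))

/-- The number of positions in the document, in terms of the input. -/
abbrev nPositions : RamNum := .add docLength (.const 1)

/-- Create the children of the node on the current path with the depth in array `40`. The
children of nodes are in array `11`, the path in array `12`, the number of nodes in array `22`, the
values of nodes in semiring array `4`. -/
def expandNode : RamProg :=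
  .seq (.setNum 11 (.load 12 (cell 40)) (cell 22))
    (forLoop 41 nPositions
      (.seq (.setNum 10 (cell 40) (.add (cell 41) (.const 1)))
        (.seq bestRun
          (.seq (.setWt 4 (cell 22) (.load 5 (.const 0)))
            (.setNum 22 (.const 0) (.add (cell 22) (.const 1)))))))

/-- Go on with a child of maximal value. -/
def selectChild : RamProg :=
  forLoop 41 nPositions
    (.ite (.wtLE (.load 4 (.load 12 (cell 40)))
        (.load 4 (.add (.load 11 (.load 12 (cell 40))) (cell 41))))
      (.seq (.setNum 10 (cell 40) (.add (cell 41) (.const 1)))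
        (.setNum 12 (.add (cell 40) (.const 1))
          (.add (.load 11 (.load 12 (cell 40))) (cell 41))))
      .skip)

/-- Find the leaf of a best answer. -/
def descend : RamProg :=
  forLoop 40 answerLength
    (.seq (.ite (.numLE (.load 11 (.load 12 (cell 40))) (.const 0)) expandNode .skip) selectChild)

end RamProg

namespace WeightedVSA.Listing

open RamProg

section Arrays

variable {β : Type*} [Zero β]

theorem arrayOf_of_le {l : List β} {i : ℕ} (h : l.length ≤ i) : arrayOf l i = 0 := by
  simp [arrayOf, List.getElem?_eq_none h]

theorem arrayOf_of_lt {l : List β} {i : ℕ} (h : i < l.length) : arrayOf l i = l[i] := by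
  simp [arrayOf, h]

theorem eq_arrayOf_snoc {c : ℕ → β} {l : List β} {x : β}
    (h : ∀ i, i ≠ l.length → c i = arrayOf l i) (hx : c l.length = x) :
    c = arrayOf (l ++ [x]) := by
  funext i
  rcases eq_or_ne i l.length with rfl | hi
  · simp [arrayOf, hx]
  · rw [h i hi]
    rcases lt_or_gt_of_ne hi with h1 | h1
    · simp [arrayOf, List.getElem?_append_left h1]
    · rw [arrayOf_of_le h1.le, arrayOf_of_le (by simpa using h1)]

end Arrays

variable {K α V Q : Type*} [CommSemiring K] [LinearOrder K] {A : WeightedVSA K α V Q}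
  {L : A.Listing} {d : List α} {s s' : RamStore K} {Y : ℕ}

variable (L) in
/-- The input and the constants that the search for best runs uses are in place. -/
structure IsReady (d : List α) (s : RamStore K) : Prop extends L.InputIn d s where
  lastRow : s.num 20 0 = d.length * Nat.card Q
  rounds : s.num 21 0 = (d.length + L.transitions.length + 1) * (Nat.card Q + 1)

omit [LinearOrder K] in
theorem IsReady.of_frame {c : RamProg} (h : L.IsReady d s) (hF : c.Frame s s')
    (hn : ∀ a ∈ [0, 1, 2, 3, 4, 5, 20, 21], a ∉ c.numMods) (hw : ∀ a < 3, a ∉ c.wtMods) :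
    L.IsReady d s' where
  toInputIn := h.toInputIn.of_frame hF (fun a ha => hn a (by interval_cases a <;> simp)) hw
  lastRow := by rw [hF.num 20 (hn 20 (by simp)), h.lastRow]
  rounds := by rw [hF.num 21 (hn 21 (by simp)), h.rounds]

omit [LinearOrder K] in
theorem IsReady.setNum (h : L.IsReady d s) {a : ℕ} (ha : a ∉ [0, 1, 2, 3, 4, 5, 20, 21])
    (i v : ℕ) : L.IsReady d (s.setNum a i v) := by
  refine h.of_frame (c := .setNum a (.const i) (.const v)) ⟨fun b hb => ?_, fun _ _ => rfl⟩
    (fun b hb hb' => ?_) (by simp [wtMods])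
  · simp only [numMods, List.mem_singleton] at hb
    simp [hb]
  · simp only [numMods, List.mem_singleton] at hb'
    exact ha (hb' ▸ hb)

variable (L) in
/-- The program `bestRun` finds the maximal value of `f` on the words that continue the one in
array `10`. -/
def BestRunFinds (d : List α) (f : List ℕ → K) (Y : ℕ) : Prop :=
  ∀ (s : RamStore K) (w : List ℕ), L.IsReady d s →
    IsBoundedWord (d.length + 1) (Nat.card V + Nat.card V) w → s.num 10 = arrayOf w →
    Ensures Y bestRun (fun s' => IsMaxOrZero
      (wordWeights (d.length + 1) (Nat.card V + Nat.card V) f ∅ w) (s'.wt 5 0)) s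

variable {f : List ℕ → K}

/-- Cell `w.length` of array `10` is where the possible next positions are tried out one after the
other. Its contents are therefore left open before and after. -/
theorem ensures_expandNode (hbest : L.BestRunFinds d f Y) (hd : d.length + 1 ≤ Y) {w : List ℕ}
    (hw : IsBoundedWord (d.length + 1) (Nat.card V + Nat.card V) w)
    (hlt : w.length < Nat.card V + Nat.card V) (h : L.IsReady d s) (hk : s.num 40 0 = w.length)
    (hc : ∀ i, i ≠ w.length → s.num 10 i = arrayOf w i) :
    Ensures Y expandNode (fun s' =>
      s'.num 11 = Function.update (s.num 11) (s.num 12 w.length) (s.num 22 0) ∧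
      s'.num 22 0 = s.num 22 0 + (d.length + 1) ∧
      (∀ i, i ≠ w.length → s'.num 10 i = arrayOf w i) ∧
      (∀ n < s.num 22 0, s'.wt 4 n = s.wt 4 n) ∧
      ∀ p < d.length + 1, IsMaxOrZero
        (wordWeights (d.length + 1) (Nat.card V + Nat.card V) f ∅ (w ++ [p + 1]))
        (s'.wt 4 (s.num 22 0 + p))) s := by
  refine .seq (.setNum ?_)
  simp only [RamNum.val, hk]
  set s₀ := s.setNum 11 (s.num 12 w.length) (s.num 22 0)
  have h₀ : L.IsReady d s₀ := h.setNum (by decide) _ _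
  refine .forLoop (d.length + 1) hd (fun k s' => s'.num 22 0 = s.num 22 0 + k ∧
      (∀ i, i ≠ w.length → s'.num 10 i = arrayOf w i) ∧
      (∀ n < s.num 22 0, s'.wt 4 n = s.wt 4 n) ∧
      ∀ p < k, IsMaxOrZero
        (wordWeights (d.length + 1) (Nat.card V + Nat.card V) f ∅ (w ++ [p + 1]))
        (s'.wt 4 (s.num 22 0 + p))) (by decide) (by decide)
      (by simp [RamNum.val, h₀.length_doc]) ?_ ?_ ?_
  · simpa [s₀] using hc
  · rintro k s₁ hk' ⟨htop, hc₁, hR, hR'⟩ hF hs41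
    have hs40 : s₁.num 40 0 = w.length := by
      rw [hF.num 40 (by decide)]
      simpa [s₀] using hk
    refine .seq (.setNum (.seq ?_))
    simp only [RamNum.val, hs40, hs41]
    have hr : L.IsReady d (s₁.setNum 10 w.length (k + 1)) :=
      (h₀.of_frame hF (by decide) (by decide)).setNum (by decide) _ _
    refine (hbest _ (w ++ [k + 1]) hr (hw.snoc hlt hk') ?_).mono ?_
    · refine eq_arrayOf_snoc (fun i hi => ?_) (by simp)
      simp [hi, hc₁ i hi]
    · intro s₂ hF₂ hM
      have e22 : s₂.num 22 0 = s.num 22 0 + k := by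
        rw [hF₂.num 22 (by decide)]
        simpa using htop
      have e4 : s₂.wt 4 = s₁.wt 4 := hF₂.wt 4 (by decide)
      have e10 : s₂.num 10 = Function.update (s₁.num 10) w.length (k + 1) := by
        rw [hF₂.num 10 (by decide)]
        simp
      refine .seq (.setWt (.setNum ⟨?_, ?_, ?_, ?_⟩)) <;>
        simp only [RamNum.val, RamWt.val, RamStore.setNum_wt, RamStore.setWt_num,
          RamStore.setWt_wt_self, RamStore.setNum_num_self, e22, e4, ne_eq, not_false_eq_true,
          RamStore.setNum_num_of_ne, Nat.reduceEqDiff, e10]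
      · simp [add_assoc]
      · intro i hi
        simp [hi, hc₁ i hi]
      · intro n hn
        rw [Function.update_of_ne (by omega), hR n hn]
      · intro p hp
        rcases Nat.lt_succ_iff_lt_or_eq.1 hp with h1 | rfl
        · rw [Function.update_of_ne (by omega)]
          exact hR' p h1
        · simpa using hM
  · rintro s₁ ⟨htop, hc₁, hR, hR'⟩ hF
    refine ⟨?_, htop, hc₁, hR, hR'⟩
    rw [hF.num 11 (by decide)]
    simp [s₀]

/-- The loop ends with the last child that is worth at least as much as its parent. It writes only
at depth `w.length + 1` of the path, so all comparisons refer to the same parent. -/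
theorem ensures_selectChild (hd : d.length + 1 ≤ Y) {w : List ℕ} {ch : ℕ} (h : L.InputIn d s)
    (hk : s.num 40 0 = w.length) (hc : ∀ i, i ≠ w.length → s.num 10 i = arrayOf w i)
    (hch : s.num 11 (s.num 12 w.length) = ch)
    (hex : ∃ p < d.length + 1, s.wt 4 (s.num 12 w.length) ≤ s.wt 4 (ch + p)) :
    Ensures Y selectChild (fun s' => ∃ p < d.length + 1,
      s.wt 4 (s.num 12 w.length) ≤ s.wt 4 (ch + p) ∧ s'.num 10 = arrayOf (w ++ [p + 1]) ∧
      s'.num 12 = Function.update (s.num 12) (w.length + 1) (ch + p)) s := by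
  refine .forLoop (d.length + 1) hd (fun k s' => (∀ i, i ≠ w.length → s'.num 10 i = arrayOf w i) ∧
      (∀ i, i ≠ w.length + 1 → s'.num 12 i = s.num 12 i) ∧
      ((∃ p < k, s.wt 4 (s.num 12 w.length) ≤ s.wt 4 (ch + p) ∧ s'.num 10 w.length = p + 1 ∧
        s'.num 12 (w.length + 1) = ch + p) ∨
      ∀ p < k, ¬ s.wt 4 (s.num 12 w.length) ≤ s.wt 4 (ch + p)))
    (by decide) (by decide) (by simp [RamNum.val, h.length_doc]) ?_ ?_ ?_
  · simpa using hc
  · rintro k s₁ hk' ⟨hc₁, hp₁, hor⟩ hF hs41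
    have e40 : s₁.num 40 0 = w.length := by rw [hF.num 40 (by decide), hk]
    have e11 : s₁.num 11 = s.num 11 := hF.num 11 (by decide)
    have e4 : s₁.wt 4 = s.wt 4 := hF.wt 4 (by decide)
    have e12 : s₁.num 12 w.length = s.num 12 w.length := hp₁ _ (by omega)
    refine .ite (fun hle => ?_) fun hle => ?_ <;>
      simp only [RamTest.Holds, RamWt.val, RamNum.val, e40, e11, e4, e12, hch, hs41] at hle
    · refine .seq (.setNum (.setNum ⟨?_, ?_, .inl ⟨k, by omega, hle, ?_, ?_⟩⟩))
      · intro i hi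
        simp [RamNum.val, e40, hi, hc₁ i hi]
      · intro i hi
        simp [RamNum.val, e40, hi, hp₁ i hi]
      · simp [RamNum.val, e40, hs41]
      · simp [RamNum.val, e40, hs41, e12, e11, hch]
    · refine .skip ⟨by simpa using hc₁, by simpa using hp₁, ?_⟩
      rcases hor with ⟨p, hp, h1, h2, h3⟩ | hno
      · exact .inl ⟨p, by omega, h1, by simpa using h2, by simpa using h3⟩
      · refine .inr fun p hp => ?_
        rcases Nat.lt_succ_iff_lt_or_eq.1 hp with h1 | rfl
        · exact hno p h1
        · exact hle
  · rintro s₁ ⟨hc₁, hp₁, hor⟩ hF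
    rcases hor with ⟨p, hp, h1, h2, h3⟩ | hno
    · refine ⟨p, hp, h1, eq_arrayOf_snoc hc₁ h2, ?_⟩
      funext i
      rcases eq_or_ne i (w.length + 1) with rfl | hi
      · simp [h3]
      · simp [hi, hp₁ i hi]
    · obtain ⟨p, hp, hle⟩ := hex
      exact absurd hle (hno p hp)

variable (L) in
/-- In the search for an answer of weight at least `w₀` outside `out`, the path has been completed
to the depth `k`. -/
structure IsDescent (d : List α) (f : List ℕ → K) (out : Set (List ℕ)) (w₀ : K) (k : ℕ)
    (s : RamStore K) (π : ℕ → List ℕ) : Prop extends L.IsReady d s where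
  tree : IsWeightedTree (d.length + 1) (Nat.card V + Nat.card V) f out (s.num 11) (s.num 22 0)
    (s.wt 4) π
  root : s.num 12 0 = 0
  lt_top : ∀ j ≤ k, s.num 12 j < s.num 22 0
  length : ∀ j ≤ k, (π (s.num 12 j)).length = j
  isPrefix : ∀ j ≤ k, π (s.num 12 j) <+: π (s.num 12 k)
  inner : ∀ j < k, s.num 11 (s.num 12 j) ≠ 0
  positions : ∀ i, i ≠ k → s.num 10 i = arrayOf (π (s.num 12 k)) i
  weight_le : w₀ ≤ s.wt 4 (s.num 12 k)

theorem ensures_descend_step [IsOrderedRing K] (hnonneg : ∀ a : K, 0 ≤ a)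
    (hbest : L.BestRunFinds d f Y) (hd : d.length + 1 ≤ Y) {out : Set (List ℕ)} {w₀ : K}
    (hw₀ : w₀ ≠ 0) {k : ℕ} (hk : k < Nat.card V + Nat.card V) {π : ℕ → List ℕ}
    (h : L.IsDescent d f out w₀ k s π) (hs40 : s.num 40 0 = k) :
    Ensures Y (.seq (.ite (.numLE (.load 11 (.load 12 (.cell 40))) (.const 0)) expandNode .skip)
      selectChild) (fun s' => (∃ π, L.IsDescent d f out w₀ (k + 1) s' π) ∧
        s'.num 10 (k + 1) = 0) s := by
  have hlen := h.length k le_rfl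
  have hlt := h.lt_top k le_rfl
  -- Once the node at depth `k` has children, its nonzero value is attained by some word. The child
  -- given by the next entry of this word is worth at least as much, so the selection succeeds.
  have hsel : ∀ s' π', L.IsDescent d f out w₀ k s' π' → s'.num 11 (s'.num 12 k) ≠ 0 →
      s'.num 40 0 = k → Ensures Y selectChild (fun s' =>
        (∃ π, L.IsDescent d f out w₀ (k + 1) s' π) ∧ s'.num 10 (k + 1) = 0) s' := by
    intro s₁ π₁ h₁ hch hk₁
    have hlen₁ := h₁.length k le_rfl
    have hlt₁ := h₁.lt_top k le_rfl
    have hsel := ensures_selectChild (s := s₁) (w := π₁ (s₁.num 12 k)) hd h₁.toInputIn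
      (hk₁.trans hlen₁.symm) (by rw [hlen₁]; exact h₁.positions) rfl
    rw [hlen₁] at hsel
    refine (hsel ?_).mono ?_
    · have hM := h₁.tree.value _ hlt₁
      rcases hM.eq with h0 | hin
      · exact absurd (le_antisymm (h0 ▸ h₁.weight_le) (hnonneg _)) hw₀
      · rw [wordWeights_eq_iUnion (hlen₁.trans_lt hk)] at hin
        obtain ⟨p, hp, hin⟩ := hin
        obtain ⟨h2, h3⟩ := h₁.tree.child _ hlt₁ hch p hp
        exact ⟨p, hp, (h3 ▸ h₁.tree.value _ h2).le _ hin⟩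
    · rintro s₂ hF ⟨p, hp, hle, e10, e12⟩
      obtain ⟨h2, h3⟩ := h₁.tree.child _ hlt₁ hch p hp
      have e11 : s₂.num 11 = s₁.num 11 := hF.num 11 (by decide)
      have e22 : s₂.num 22 = s₁.num 22 := hF.num 22 (by decide)
      have e4 : s₂.wt 4 = s₁.wt 4 := hF.wt 4 (by decide)
      have hlast : s₂.num 12 (k + 1) = s₁.num 11 (s₁.num 12 k) + p := by simp [e12]
      have hold : ∀ j ≤ k, s₂.num 12 j = s₁.num 12 j := fun j hj => by
        rw [e12, Function.update_of_ne (by omega)]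
      have e10' : s₂.num 10 = arrayOf (π₁ (s₂.num 12 (k + 1))) := by rw [e10, hlast, h3]
      refine ⟨⟨π₁, ?_⟩, ?_⟩
      · refine ⟨h₁.toIsReady.of_frame hF (by decide) (by decide), ?_, ?_, ?_, ?_, ?_, ?_, ?_, ?_⟩
        · rw [e11, e22, e4]
          exact h₁.tree
        · rw [hold 0 (Nat.zero_le _), h₁.root]
        · intro j hj
          rcases Nat.le_succ_iff.1 hj with hj | rfl
          · rw [hold j hj, e22]
            exact h₁.lt_top j hj
          · rw [hlast, e22]
            exact h2
        · intro j hj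
          rcases Nat.le_succ_iff.1 hj with hj | rfl
          · rw [hold j hj]
            exact h₁.length j hj
          · simp [hlast, h3, hlen₁]
        · intro j hj
          rcases Nat.le_succ_iff.1 hj with hj | rfl
          · rw [hold j hj, hlast, h3]
            exact (h₁.isPrefix j hj).trans (List.prefix_append ..)
          · exact List.prefix_rfl
        · intro j hj
          rw [hold j (by omega), e11]
          rcases Nat.lt_succ_iff_lt_or_eq.1 hj with hj | rfl
          · exact h₁.inner j hj
          · exact hch
        · exact fun i _ => congrFun e10' i
        · rw [hlast, e4]
          exact h₁.weight_le.trans hle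
      · rw [e10', arrayOf_of_le]
        simp [hlast, h3, hlen₁]
  refine .seq (.ite (fun hle => ?_) fun hle => .skip (hsel s π h ?_ hs40)) <;>
    simp only [RamTest.Holds, RamNum.val, hs40, Nat.le_zero] at hle
  · have hexp := ensures_expandNode (s := s) (w := π (s.num 12 k)) hbest hd (h.tree.bounded _ hlt)
      (hlen.trans_lt hk) h.toIsReady (hs40.trans hlen.symm) (by rw [hlen]; exact h.positions)
    rw [hlen] at hexp
    refine hexp.mono fun s₁ hF ⟨e11, e22, e10, hR, hR'⟩ => hsel s₁
      (IsPrefixTree.expandWords (s.num 22 0) π (s.num 12 k)) ?_ ?_ ?_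
    · have e12 : s₁.num 12 = s.num 12 := hF.num 12 (by decide)
      have hold : ∀ j ≤ k, IsPrefixTree.expandWords (s.num 22 0) π (s.num 12 k) (s₁.num 12 j) =
          π (s.num 12 j) := fun j hj => by
        rw [e12, IsPrefixTree.expandWords_of_lt (h.lt_top j hj)]
      refine ⟨h.toIsReady.of_frame hF (by decide) (by decide), ?_, ?_, ?_, ?_, ?_, ?_, ?_, ?_⟩
      · rw [e11, e22]
        exact h.tree.expand (by omega) hlt hle (hlen.trans_lt hk) hR hR'
      · rw [e12, h.root]
      · intro j hj
        rw [e12, e22]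
        have := h.lt_top j hj
        omega
      · intro j hj
        rw [hold j hj, h.length j hj]
      · intro j hj
        rw [hold j hj, hold k le_rfl]
        exact h.isPrefix j hj
      · intro j hj
        rw [e11, e12, Function.update_of_ne]
        · exact h.inner j hj
        -- The expanded node has depth `k`, so it differs from the path nodes of smaller depth.
        · intro he
          have h1 := h.length j hj.le
          rw [he] at h1
          omega
      · intro i hi
        rw [hold k le_rfl]
        exact e10 i hi
      · rw [e12, hR _ hlt]
        exact h.weight_le
    · rw [e11, hF.num 12 (by decide), Function.update_self]
      exact h.tree.top_pos.ne'
    · rw [hF.num 40 (by decide), hs40]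
  · exact hle

end WeightedVSA.Listing

/-! ### Writing an answer and removing it from the tree -/

namespace RamProg

open RamNum (cell)

/-- Write the answer in array `10`. -/
def emit : RamProg :=
  .seq (.setNum 43 (.const 0) (.const 0)) (.seq (.write (.load 10 (.const 0)))
    (.while (.not (.numLE answerLength (cell 43)))
      (.seq (.setNum 43 (.const 0) (.add (cell 43) (.const 1))) (.write (.load 10 (cell 43))))))

/-- Remove the answer at the end of the path and update the values on the path. -/
def retract : RamProg :=
  .seq (.setWt 4 (.load 12 answerLength) .zero)
    (forLoop 40 answerLength
      (.seq (.setNum 42 (.const 0) (.sub answerLength (.add (cell 40) (.const 1))))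
        (.seq (.setNum 10 (cell 42) (.const 0))
          (.seq (.setWt 5 (.const 0) .zero)
            (.seq (forLoop 41 nPositions (.setWt 5 (.const 0) (.add (.load 5 (.const 0))
                (.load 4 (.add (.load 11 (.load 12 (cell 42))) (cell 41))))))
              (.setWt 4 (.load 12 (cell 42)) (.load 5 (.const 0))))))))

/-- Write all answers. -/
def answers : RamProg :=
  .while (.not (.wtLE (.load 4 (.const 0)) .zero)) (.seq descend (.seq emit retract))

section

variable {K : Type*} [CommSemiring K] [LinearOrder K] {s : RamStore K} {D Y : ℕ}

theorem exec_emit_while (n : ℕ) {k : ℕ} (hs43 : s.num 43 0 = k)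
    (hD : answerLength.val s = k + n) : ∃ T s',
    Exec (.while (.not (.numLE answerLength (cell 43)))
      (.seq (.setNum 43 (.const 0) (.add (cell 43) (.const 1))) (.write (.load 10 (cell 43)))))
      s T s' ∧ T.reduceOption = (List.range' (k + 1) n).map (s.num 10) ∧
      T.length ≤ (n + 1) * 10 + n * 10 := by
  induction n generalizing s k with
  | zero =>
    refine ⟨_, s, .while_false ?_, by simp, by simp [RamTest.cost, RamNum.cost]⟩
    simp only [RamNum.val, add_zero] at hD
    simp [RamTest.Holds, RamNum.val, hs43, hD]
  | succ n ih =>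
    set s₁ := s.setNum 43 0 (k + 1) with hs₁
    obtain ⟨T, s', he, hT, hl⟩ := ih (s := s₁) (k := k + 1) (by simp [s₁]) (by
      simp only [RamNum.val] at hD
      simp [s₁, RamNum.val, hD]
      omega)
    have h1 : Exec (.setNum 43 (.const 0) (.add (cell 43) (.const 1))) s (.silent 6) s₁ := by
      have := Exec.setNum 43 (.const 0) (.add (cell 43) (.const 1)) s
      simp only [RamNum.val, hs43] at this
      exact this
    refine ⟨_, s', .while_true ?_ (.seq h1 (.write _ s₁)) he, ?_, ?_⟩
    · simp only [RamNum.val] at hD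
      simp [RamTest.Holds, hD, RamNum.val, hs43]
    · simp [List.reduceOption_append, hT, RamNum.val, s₁, List.range'_succ]
    · simp [RamTest.cost, RamNum.cost] at hl ⊢
      omega

/-- The end mark needs no instruction of its own: it is the zero in array `10` just after the word.
The first symbol is written before the loop, so that the silent steps in front of it can be counted
separately. -/
theorem exec_emit {u : List ℕ} (hu : answerLength.val s = u.length) (hY : u.length ≤ Y)
    (hc : s.num 10 = WeightedVSA.Listing.arrayOf u) : ∃ (a : ℕ) (T : RamTrace) (s' : RamStore K),
    Exec emit s (.silent a ++ T) s' ∧ a ≤ 10 ∧ (∃ x T', T = some x :: T') ∧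
      T.reduceOption = u ++ [0] ∧ T.length ≤ (Y + 1) * 20 := by
  set s₁ := s.setNum 43 0 0 with hs₁
  obtain ⟨T, s', he, hT, hl⟩ := exec_emit_while (s := s₁) u.length (k := 0) (by simp [s₁]) (by
    simpa [s₁, RamNum.val] using hu)
  have h1 : Exec (.setNum 43 (.const 0) (.const 0)) s (.silent 3) s₁ := Exec.setNum ..
  -- Three steps to reset the counter and two to evaluate the first cell.
  refine ⟨5, some (s₁.num 10 0) :: T, s', ?_, by norm_num, ⟨_, _, rfl⟩, ?_, ?_⟩
  · have := Exec.seq h1 (.seq (.write (.load 10 (.const 0)) s₁) he)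
    rw [List.append_assoc, ← List.append_assoc, ← RamTrace.silent_add] at this
    exact this
  · have h2 : s₁.num 10 = WeightedVSA.Listing.arrayOf u := by simp [s₁, hc]
    rw [List.reduceOption_cons_of_some, hT, h2, ← List.map_cons]
    have : 0 :: List.range' (0 + 1) u.length = List.range (u.length + 1) := by
      rw [List.range_eq_range', List.range'_succ]
    rw [this]
    refine List.ext_getElem (by simp) fun i h3 h4 => ?_
    simp only [List.length_append, List.length_singleton] at h4
    simp only [List.getElem_map, List.getElem_range]
    rcases Nat.lt_succ_iff_lt_or_eq.1 h4 with h5 | rfl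
    · rw [WeightedVSA.Listing.arrayOf_of_lt h5, List.getElem_append_left h5]
    · rw [WeightedVSA.Listing.arrayOf_of_le le_rfl]
      simp
  · simp only [List.length_cons]
    omega

end

end RamProg

namespace WeightedVSA.Listing

open RamProg

variable {K α V Q : Type*} [CommSemiring K] [LinearOrder K] {A : WeightedVSA K α V Q}
  {L : A.Listing} {d : List α} {s s' : RamStore K} {Y : ℕ} {f : List ℕ → K}

omit [LinearOrder K] in
theorem InputIn.answerLength (h : L.InputIn d s) :
    answerLength.val s = Nat.card V + Nat.card V := by
  simp [RamNum.val, h.num_vars]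

variable (L) in
/-- Between two answers: the tree represents the answers that are not in `out`. -/
structure IsIdle (d : List α) (f : List ℕ → K) (out : Set (List ℕ)) (s : RamStore K)
    (π : ℕ → List ℕ) : Prop extends L.IsReady d s where
  tree : IsWeightedTree (d.length + 1) (Nat.card V + Nat.card V) f out (s.num 11) (s.num 22 0)
    (s.wt 4) π
  root : s.num 12 0 = 0
  positions : ∀ i, s.num 10 i = 0

theorem ensures_descend [IsOrderedRing K] (hnonneg : ∀ a : K, 0 ≤ a)
    (hbest : L.BestRunFinds d f Y) (hd : d.length + 1 ≤ Y) (hD : Nat.card V + Nat.card V ≤ Y)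
    {out : Set (List ℕ)} (h0 : s.wt 4 0 ≠ 0) {π : ℕ → List ℕ} (h : L.IsIdle d f out s π) :
    Ensures Y descend (fun s' =>
      (∃ π, L.IsDescent d f out (s.wt 4 0) (Nat.card V + Nat.card V) s' π) ∧
      s'.num 10 (Nat.card V + Nat.card V) = 0) s := by
  refine .forLoop _ hD (fun k s' => (∃ π, L.IsDescent d f out (s.wt 4 0) k s' π) ∧
    s'.num 10 k = 0) (by decide) (by decide) h.answerLength ⟨⟨π, ?_⟩, ?_⟩ ?_ fun s₁ h₁ _ => h₁
  · refine ⟨h.toIsReady.setNum (by decide) _ _, by simpa using h.tree, by simpa using h.root,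
      ?_, ?_, ?_, ?_, ?_, ?_⟩
    · simpa [h.root] using h.tree.top_pos
    · simp [h.root, h.tree.root]
    · simp
    · simp
    · simp [h.root, h.tree.root, h.positions, arrayOf]
    · simp [h.root]
  · simpa using h.positions 0
  · rintro k s₁ hk ⟨⟨π₁, h₁⟩, -⟩ hF hs40
    refine (ensures_descend_step hnonneg hbest hd h0 hk h₁ hs40).mono ?_
    rintro s₂ - ⟨⟨π₂, h₂⟩, hp⟩
    refine ⟨⟨π₂, h₂.toIsReady.setNum (by decide) _ _, by simpa using h₂.tree,
      by simpa using h₂.root, by simpa using h₂.lt_top, by simpa using h₂.length,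
      by simpa using h₂.isPrefix, by simpa using h₂.inner, by simpa using h₂.positions,
      by simpa using h₂.weight_le⟩, by simpa using hp⟩

section Retract

variable {out : Set (List ℕ)} {w₀ : K} {k : ℕ} {π : ℕ → List ℕ}

/-- Two prefixes of the same word that have equal length coincide, and distinct nodes have distinct
words. So the nodes above the end of the path are exactly the nodes on the path. -/
theorem IsDescent.eq_of_isPrefix (h : L.IsDescent d f out w₀ k s π) {n : ℕ} (hn : n < s.num 22 0)
    (hp : π n <+: π (s.num 12 k)) : s.num 12 (π n).length = n := by
  have hle : (π n).length ≤ k := by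
    rw [← h.length k le_rfl]
    exact hp.length_le
  refine h.tree.inj _ (h.lt_top _ hle) _ hn ?_
  have h1 := h.length _ hle
  exact (List.prefix_of_prefix_length_le (h.isPrefix _ hle) hp h1.le).eq_of_length h1

/-- The new word has only path nodes above it, and those of depth less than `2|V|` have children. So
`leaf` survives. -/
theorem IsDescent.insert (h : L.IsDescent d f out w₀ (Nat.card V + Nat.card V) s π) :
    IsPrefixTree (d.length + 1) (Nat.card V + Nat.card V)
      (insert (π (s.num 12 (Nat.card V + Nat.card V))) out) (s.num 11) (s.num 22 0) π where
  __ := h.tree.toIsPrefixTree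
  leaf n hn hch hlen u hu hp := by
    rcases hu with rfl | hu
    · refine h.inner _ hlen ?_
      rwa [h.eq_of_isPrefix hn hp]
    · exact h.tree.leaf n hn hch hlen u hu hp

theorem ensures_retract [IsOrderedRing K] (hnonneg : ∀ a : K, 0 ≤ a)
    (hbip : ∀ a b : K, a + b = a ∨ a + b = b) (hd : d.length + 1 ≤ Y)
    (hD : Nat.card V + Nat.card V ≤ Y)
    (h : L.IsDescent d f out w₀ (Nat.card V + Nat.card V) s π)
    (hpos : s.num 10 (Nat.card V + Nat.card V) = 0) :
    Ensures Y retract (fun s' => L.IsIdle d f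
      (insert (π (s.num 12 (Nat.card V + Nat.card V))) out) s' π) s := by
  have hans := h.toInputIn.answerLength
  set D := Nat.card V + Nat.card V with hDdef
  set u := π (s.num 12 D) with hu
  have hlu : u.length = D := h.length D le_rfl
  refine .seq (.setWt ?_)
  simp only [RamNum.val] at hans
  simp only [RamNum.val, RamWt.val, hans]
  set s₀ := s.setWt 4 (s.num 12 D) 0 with hs₀
  have h₀ : L.IsReady d s₀ := by
    refine h.toIsReady.of_frame (c := .setWt 4 (.const 0) .zero) ⟨fun _ _ => rfl, fun a ha => ?_⟩
      (by decide) (by decide)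
    simp only [wtMods, List.mem_singleton] at ha
    simp [s₀, ha]
  -- After `k` rounds the values for `insert u out` are correct off the path and at depths at least
  -- `D - k`, and array `10` is zero from `D - k` on.
  refine .forLoop D hD (fun k s' => (∀ i, D ≤ i + k → s'.num 10 i = 0) ∧
    ∀ n < s.num 22 0, ¬ π n <+: u ∨ D ≤ (π n).length + k → IsMaxOrZero
      (wordWeights (d.length + 1) D f (insert u out) (π n)) (s'.wt 4 n))
    (by decide) (by decide) h₀.answerLength ⟨?_, ?_⟩ ?_ ?_
  · intro i hi
    simp only [add_zero] at hi
    rcases hi.eq_or_lt with rfl | hi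
    · simpa [s₀] using hpos
    · simp only [RamStore.setNum_num_of_ne, s₀, RamStore.setWt_num, ne_eq, Nat.reduceEqDiff,
        not_false_eq_true]
      rw [h.positions i hi.ne', arrayOf_of_le]
      exact hlu.le.trans hi.le
  · intro n hn hor
    simp only [RamStore.setNum_wt, s₀, RamStore.setWt_wt_self, Function.update_apply]
    split_ifs with he
    · subst he
      -- Below the end of the path, `u` is the only word of full length, and it is now excluded.
      convert IsMaxOrZero.empty
      rw [Set.eq_empty_iff_forall_notMem]
      rintro w ⟨u', -, hl, hno, hp, -⟩
      exact hno (.inl (hp.eq_of_length (hlu.trans hl.symm)).symm)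
    · have hnp : ¬ π n <+: u := by
        rcases hor with hor | hor
        · exact hor
        · intro hp
          have h1 := h.eq_of_isPrefix hn hp
          have h2 := hp.length_le
          rw [show (π n).length = D by omega] at h1
          exact he h1.symm
      rw [wordWeights_congr (out' := out)]
      · exact h.tree.value n hn
      · intro u' hu'
        refine ⟨?_, .inr⟩
        rintro (rfl | h')
        · exact absurd hu' hnp
        · exact h'
  · rintro k s₁ hk ⟨hc, hR⟩ hF hs40
    have h₁ : L.IsReady d s₁ := h₀.of_frame hF (by decide) (by decide)
    have hans₁ := h₁.toInputIn.answerLength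
    simp only [RamNum.val] at hans₁
    obtain ⟨j, hj⟩ : ∃ j, D = j + (k + 1) := ⟨D - (k + 1), by omega⟩
    have e11 : s₁.num 11 = s.num 11 := hF.num 11 (by decide)
    have e12 : s₁.num 12 = s.num 12 := hF.num 12 (by decide)
    have hjD : j < D := by omega
    have hv := h.lt_top j hjD.le
    have hlv := h.length j hjD.le
    refine .seq (.setNum (.seq (.setNum (.seq (.setWt (.seq ?_))))))
    simp only [RamNum.val, RamWt.val, hans₁, hs40, ← hDdef,
      show D - (k + 1) = j by omega, RamStore.setNum_num_self, Function.update_self]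
    set s₂ := ((s₁.setNum 42 0 j).setNum 10 j 0).setWt 5 0 0 with hs₂
    have f11 : s₂.num 11 = s.num 11 := by simp [s₂, e11]
    have f12 : s₂.num 12 = s.num 12 := by simp [s₂, e12]
    have f4 : s₂.wt 4 = s₁.wt 4 := by simp [s₂]
    have f42 : s₂.num 42 0 = j := by simp [s₂]
    refine .forLoop (d.length + 1) hd (fun p s' => IsMaxOrZero
      {w | ∃ p' < p, w ∈ wordWeights (d.length + 1) D f (insert u out)
        (π (s.num 12 j) ++ [p' + 1])} (s'.wt 5 0)) (by decide) (by decide) ?_ ?_ ?_ ?_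
    · simpa [RamNum.val, s₂] using h₁.length_doc
    · simpa [s₂] using IsMaxOrZero.empty
    · intro p s₃ hp hM hF₃ hs41
      refine .setWt ?_
      simp only [RamNum.val, RamWt.val, RamStore.setNum_wt, RamStore.setWt_wt_self,
        Function.update_self, hF₃.num 42 (by decide), hF₃.num 12 (by decide),
        hF₃.num 11 (by decide), hF₃.wt 4 (by decide), f11, f12, f4, f42, hs41]
      obtain ⟨h1, h2⟩ := h.tree.child _ hv (h.inner j hjD) p hp
      -- The child has depth `j + 1 = D - k`, so its value has already been corrected.
      have hM' := hR _ h1 (.inr (by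
        rw [h2, List.length_append, List.length_singleton]
        omega))
      rw [h2] at hM'
      convert hM.union hnonneg hbip hM' using 1
      ext w
      simp only [Set.mem_ofPred_eq, Set.mem_union]
      constructor
      · rintro ⟨p', hp', hw⟩
        rcases Nat.lt_succ_iff_lt_or_eq.1 hp' with h3 | rfl
        · exact .inl ⟨p', h3, hw⟩
        · exact .inr hw
      · rintro (⟨p', hp', hw⟩ | hw)
        · exact ⟨p', by omega, hw⟩
        · exact ⟨p, by omega, hw⟩
    · intro s₃ hM hF₃
      rw [← wordWeights_eq_iUnion (hlv.trans_lt hjD)] at hM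
      refine .setWt ⟨?_, ?_⟩
      · intro i hi
        simp only [RamStore.setNum_num_of_ne, RamStore.setWt_num, ne_eq, Nat.reduceEqDiff,
          not_false_eq_true, hF₃.num 10 (by decide), s₂, RamStore.setNum_num_self,
          Function.update_apply]
        split_ifs
        · rfl
        · exact hc i (by omega)
      · intro n hn hor
        simp only [RamNum.val, RamWt.val, RamStore.setNum_wt, RamStore.setWt_wt_self,
          hF₃.num 42 (by decide), hF₃.num 12 (by decide), f12, f42, Function.update_apply,
          hF₃.wt 4 (by decide), f4]
        split_ifs with he
        · subst he
          exact hM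
        · refine hR n hn (or_iff_not_imp_left.2 fun hp => ?_)
          rw [not_not] at hp
          have h1 := h.eq_of_isPrefix hn hp
          rcases hor with hor | hor
          · exact absurd hp hor
          · by_contra hlt
            rw [show (π n).length = j by omega] at h1
            exact he h1.symm
  · rintro s₁ ⟨hc, hR⟩ hF
    have e11 : s₁.num 11 = s.num 11 := hF.num 11 (by decide)
    have e12 : s₁.num 12 = s.num 12 := hF.num 12 (by decide)
    have e22 : s₁.num 22 = s.num 22 := hF.num 22 (by decide)
    refine ⟨h₀.of_frame hF (by decide) (by decide), ⟨?_, ?_⟩, ?_, fun i => hc i (by omega)⟩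
    · rw [e11, e22]
      exact h.insert
    · rw [e22]
      exact fun n hn => hR n hn (.inr (by omega))
    · rw [e12, h.root]

end Retract

end WeightedVSA.Listing

/-! ### Delay and the loop over the answers -/

namespace RamTrace

theorem Enumerates.nil {n p : ℕ} (q : ℕ) (h : n ≤ p) : Enumerates (silent n) [] p q :=
  ⟨n, [], by simp, h, .nil⟩

/-- The silent beginning of the remaining computation is charged to the block of the current word;
hence `p` reappears in the bound on `q`. -/
theorem Enumerates.cons {T T' : RamTrace} {w : List ℕ} {out : List (List ℕ)} {p q m k : ℕ}
    (hT : ∃ x T', T = some x :: T') (hw : T.reduceOption = w) (hm : m ≤ p)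
    (hq : T.length + k + p ≤ q) (h : T'.Enumerates out p q) :
    Enumerates (silent m ++ T ++ silent k ++ T') (w :: out) p q := by
  obtain ⟨n, blocks, rfl, hn, hall⟩ := h
  refine ⟨m, (T ++ silent k ++ silent n) :: blocks, by simp, hm, .cons ⟨?_, ?_, ?_⟩ hall⟩
  · obtain ⟨x, T', rfl⟩ := hT
    exact ⟨x, T' ++ silent k ++ silent n, by simp⟩
  · simp [List.reduceOption_append, hw]
  · simp only [List.length_append, length_silent]
    omega

theorem Enumerates.silent_append {T : RamTrace} {out : List (List ℕ)} {p q : ℕ} (m : ℕ)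
    (h : T.Enumerates out p q) : Enumerates (silent m ++ T) out (m + p) q := by
  obtain ⟨n, blocks, rfl, hn, hall⟩ := h
  exact ⟨m + n, blocks, by rw [silent_add, List.append_assoc], by omega, hall⟩

theorem Enumerates.mono {T : RamTrace} {out : List (List ℕ)} {p q p' q' : ℕ}
    (h : T.Enumerates out p q) (hp : p ≤ p') (hq : q ≤ q') : T.Enumerates out p' q' := by
  obtain ⟨n, blocks, rfl, hn, hall⟩ := h
  exact ⟨n, blocks, rfl, hn.trans hp, hall.imp fun _ _ h => ⟨h.1, h.2.1, h.2.2.trans hq⟩⟩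

end RamTrace

namespace RamProg

/-- A bound on the time from the end of the work on one answer to the next one. -/
noncomputable def searchPoly : Polynomial ℕ := descend.costPoly + Polynomial.C 20

/-- A bound on the delay between two answers. -/
noncomputable def delayPoly : Polynomial ℕ :=
  (Polynomial.X + 1) * Polynomial.C 20 + retract.costPoly + searchPoly

end RamProg

namespace WeightedVSA.Listing

open RamProg

variable {K α V Q : Type*} [CommSemiring K] [LinearOrder K] {A : WeightedVSA K α V Q}
  {L : A.Listing} {d : List α} {Y : ℕ} {f : List ℕ → K}

/-- Induction on the number of answers that are still missing. The root value bounds all of them,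
and the word found attains it, so writing this word next keeps the order. -/
theorem exec_answers [IsOrderedRing K] (hnonneg : ∀ a : K, 0 ≤ a)
    (hbip : ∀ a b : K, a + b = a ∨ a + b = b) (hfin : {u | f u ≠ 0}.Finite)
    (hword : ∀ u, f u ≠ 0 → IsBoundedWord (d.length + 1) (Nat.card V + Nat.card V) u ∧
      u.length = Nat.card V + Nat.card V)
    (hbest : L.BestRunFinds d f Y) (hd : d.length + 1 ≤ Y)
    (hD : ∀ u, f u ≠ 0 → Nat.card V + Nat.card V ≤ Y) {s : RamStore K} {out : Set (List ℕ)}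
    {π : ℕ → List ℕ}
    (h : L.IsIdle d f out s π) : ∃ (T : RamTrace) (s' : RamStore K) (us : List (List ℕ)),
      Exec answers s T s' ∧ us.Nodup ∧ (∀ u, u ∈ us ↔ f u ≠ 0 ∧ u ∉ out) ∧
      us.Pairwise (fun u u' => f u' ≤ f u) ∧
      T.Enumerates (us.map (· ++ [0])) (searchPoly.eval Y) (delayPoly.eval Y) := by
  have hmax : IsMaxOrZero (wordWeights (d.length + 1) (Nat.card V + Nat.card V) f out [])
      (s.wt 4 0) := by
    rw [← h.tree.root]
    exact h.tree.value 0 h.tree.top_pos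
  have hmem : ∀ u, f u ≠ 0 → u ∉ out → f u ≤ s.wt 4 0 := fun u hu ho =>
    hmax.le _ ⟨u, (hword u hu).1, (hword u hu).2, ho, List.nil_prefix, rfl⟩
  have htest : (RamTest.not (.wtLE (.load 4 (.const 0)) .zero)).Holds s ↔ s.wt 4 0 ≠ 0 := by
    simp only [RamTest.Holds, RamWt.val, RamNum.val]
    rw [not_iff_not]
    exact ⟨fun h => le_antisymm h (hnonneg _), fun h => h.le⟩
  by_cases h0 : s.wt 4 0 = 0
  · refine ⟨_, s, [], .while_false (by simp [htest, h0]), by simp, fun u => ?_, by simp, ?_⟩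
    · simp only [List.not_mem_nil, ne_eq, false_iff, not_and, not_not]
      intro hu
      by_contra ho
      exact hu (le_antisymm (h0 ▸ hmem u hu ho) (hnonneg _))
    · refine .nil _ ?_
      simp [RamTest.cost, RamWt.cost, RamNum.cost, searchPoly]
  · have hDY : Nat.card V + Nat.card V ≤ Y := by
      rcases hmax.eq with h1 | ⟨u, -, -, -, -, hu⟩
      · exact absurd h1 h0
      · exact hD u (hu ▸ h0)
    obtain ⟨m₁, s₁, hm₁, he₁, ⟨π₁, h₁⟩, hpos⟩ := ensures_descend hnonneg hbest hd hDY h0 h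
    have hlen := h₁.length _ le_rfl
    set u := π₁ (s₁.num 12 (Nat.card V + Nat.card V)) with hu
    -- At full depth `u` is its own only continuation. The nonzero value of its node therefore says
    -- that `u` is not in `out` and has this value as its weight.
    obtain ⟨hle, hfu, huo⟩ : s.wt 4 0 ≤ f u ∧ f u ≠ 0 ∧ u ∉ out := by
      have hM := h₁.tree.value _ (h₁.lt_top _ le_rfl)
      have hw := h₁.weight_le
      rcases hM.eq with h1 | ⟨u', hu', hl, ho, hp, hf⟩
      · exact absurd (le_antisymm (h1 ▸ hw) (hnonneg _)) h0
      · rw [← hu] at hp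
        obtain rfl := hp.eq_of_length (hlen.trans hl.symm)
        rw [← hf] at hw
        exact ⟨hw, fun h2 => h0 (le_antisymm (h2 ▸ hw) (hnonneg _)), ho⟩
    have hc : s₁.num 10 = arrayOf u := by
      funext i
      by_cases hi : i = Nat.card V + Nat.card V
      · rw [hi, hpos, arrayOf_of_le hlen.le]
      · exact h₁.positions i hi
    obtain ⟨a, T, s₂, he₂, ha, hT, hTu, hTl⟩ := exec_emit (Y := Y)
      (h₁.toInputIn.answerLength.trans hlen.symm) (hlen.trans_le hDY) hc
    have hF := he₂.frame
    have e10 : s₂.num 10 = s₁.num 10 := hF.num 10 (by decide)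
    have e11 : s₂.num 11 = s₁.num 11 := hF.num 11 (by decide)
    have e12 : s₂.num 12 = s₁.num 12 := hF.num 12 (by decide)
    have e22 : s₂.num 22 = s₁.num 22 := hF.num 22 (by decide)
    have e4 : s₂.wt 4 = s₁.wt 4 := hF.wt 4 (by decide)
    have h₂ : L.IsDescent d f out (s.wt 4 0) (Nat.card V + Nat.card V) s₂ π₁ := by
      refine ⟨h₁.toIsReady.of_frame hF (by decide) (by decide), ?_, ?_, ?_, ?_, ?_, ?_, ?_, ?_⟩ <;>
        simp only [e10, e11, e12, e22, e4]
      exacts [h₁.tree, h₁.root, h₁.lt_top, h₁.length, h₁.isPrefix, h₁.inner, h₁.positions,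
        h₁.weight_le]
    obtain ⟨m₃, s₃, hm₃, he₃, h₃⟩ := ensures_retract hnonneg hbip hd hDY h₂ (by rw [e10, hpos])
    rw [e12, ← hu] at h₃
    have hlt : ({u | f u ≠ 0} \ insert u out).ncard < ({u | f u ≠ 0} \ out).ncard := by
      refine Set.ncard_lt_ncard ⟨Set.sdiff_subset_sdiff_right (Set.subset_insert _ _), fun hsub => ?_⟩
        hfin.sdiff
      exact (hsub ⟨hfu, huo⟩).2 (Set.mem_insert _ _)
    obtain ⟨T', s', us, he', hnd, hus, hsort, hen⟩ :=
      exec_answers hnonneg hbip hfin hword hbest hd hD h₃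
    refine ⟨_, s', u :: us, .while_true (htest.2 h0) (.seq he₁ (.seq he₂ he₃)) he', ?_, ?_, ?_, ?_⟩
    · refine List.nodup_cons.2 ⟨fun hin => ?_, hnd⟩
      exact ((hus u).1 hin).2 (Set.mem_insert _ _)
    · intro v
      rw [List.mem_cons, hus, Set.mem_insert_iff]
      by_cases hv : v = u
      · subst hv
        simp [hfu, huo]
      · simp [hv]
    · refine List.pairwise_cons.2 ⟨fun v hv => ?_, hsort⟩
      obtain ⟨hv, ho⟩ := (hus v).1 hv
      exact (hmem v hv fun h => ho (Set.mem_insert_of_mem _ h)).trans hle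
    · rw [List.map_cons]
      have := hen.cons (m := (RamTest.not (.wtLE (.load 4 (.const 0)) .zero)).cost + m₁ + a)
        (k := m₃) hT hTu ?_ ?_
      · convert this using 1
        simp only [RamTrace.silent_add, List.append_assoc]
      · simp [RamTest.cost, RamWt.cost, RamNum.cost, searchPoly]
        omega
      · simp [delayPoly]
        omega
termination_by ({u | f u ≠ 0} \ out).ncard

end WeightedVSA.Listing

/-! ## Runs and answers -/

/-- Iteration of `IsMaxOrZero.union`: finite sums are maxima. -/
theorem IsMaxOrZero.finsum_mem {K ι : Type*} [CommSemiring K] [LinearOrder K] [IsOrderedRing K]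
    (hnonneg : ∀ a : K, 0 ≤ a) (hbip : ∀ a b : K, a + b = a ∨ a + b = b) {S : Set ι}
    (hS : S.Finite) (g : ι → K) : IsMaxOrZero (g '' S) (∑ᶠ x ∈ S, g x) := by
  induction S, hS using Set.Finite.induction_on with
  | empty => simpa using IsMaxOrZero.empty
  | @insert a S ha hS ih =>
    rw [finsum_mem_insert _ ha hS, Set.image_insert_eq, Set.insert_eq]
    refine .union hnonneg hbip ⟨?_, .inr rfl⟩ ih
    rintro _ rfl
    exact le_rfl

instance DocSpan.finite {α : Type*} (d : List α) : Finite (DocSpan d) := by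
  refine Finite.of_injective (β := Fin (d.length + 2) × Fin (d.length + 2))
    (fun s => (⟨s.1.1, by have := s.2; omega⟩, ⟨s.1.2, by have := s.2; omega⟩)) fun s s' h => ?_
  simp only [Prod.mk.injEq, Fin.mk.injEq] at h
  exact Subtype.ext (Prod.ext h.1 h.2)

/-- Variable number `i` occupies the places `2i` and `2i + 1`. The indices are sums because the
machine can add numbers but not multiply them. -/
theorem List.getElem?_flatten_ofFn_pair {β : Type*} {n : ℕ} (g h : Fin n → β) (i : Fin n) :
    (List.ofFn fun i => [g i, h i]).flatten[(i + i : ℕ)]? = some (g i) ∧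
    (List.ofFn fun i => [g i, h i]).flatten[(i + i + 1 : ℕ)]? = some (h i) := by
  induction n with
  | zero => exact i.elim0
  | succ n ih =>
    rw [List.ofFn_succ]
    refine Fin.cases ?_ (fun i => ?_) i
    · simp
    · have := ih (fun i => g i.succ) (fun i => h i.succ) i
      simpa only [List.flatten_cons, Fin.val_succ,
        show (i + 1 + (i + 1) : ℕ) = (i + i) + 2 by omega,
        show (i + 1 + (i + 1) + 1 : ℕ) = (i + i + 1) + 2 by omega, List.cons_append,
        List.nil_append, List.getElem?_cons_succ] using this

theorem VSetLabel.filterMap_letter_cons {α V : Type*} (a : α) (l : List (VSetLabel α V)) :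
    (VSetLabel.letter a :: l).filterMap VSetLabel.letter? =
      a :: l.filterMap VSetLabel.letter? := rfl

namespace WeightedVSA.Listing

section

variable {K α V Q : Type*} [CommSemiring K] {A : WeightedVSA K α V Q} (L : A.Listing)
  {d : List α}

/-- The bounds of the spans of the variables, in the order of the variables. -/
noncomputable def spanWord (t : V → DocSpan d) : List ℕ :=
  (List.ofFn fun i => [(t (L.var.symm i)).1.1, (t (L.var.symm i)).1.2]).flatten

theorem length_spanWord (t : V → DocSpan d) :
    (L.spanWord t).length = Nat.card V + Nat.card V := by
  rw [spanWord, List.length_flatten, List.map_ofFn, List.sum_ofFn]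
  simp [mul_two]

theorem spanWord_opening (t : V → DocSpan d) (v : V) :
    (L.spanWord t)[(L.var v + L.var v : ℕ)]? = some (t v).1.1 := by
  have := (List.getElem?_flatten_ofFn_pair (fun i => (t (L.var.symm i)).1.1)
    (fun i => (t (L.var.symm i)).1.2) (L.var v)).1
  simpa [spanWord] using this

theorem spanWord_closing (t : V → DocSpan d) (v : V) :
    (L.spanWord t)[(L.var v + L.var v + 1 : ℕ)]? = some (t v).1.2 := by
  have := (List.getElem?_flatten_ofFn_pair (fun i => (t (L.var.symm i)).1.1)
    (fun i => (t (L.var.symm i)).1.2) (L.var v)).2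
  simpa [spanWord] using this

theorem spanWord_injective : Function.Injective (L.spanWord (d := d)) := by
  intro t t' h
  funext v
  refine Subtype.ext (Prod.ext ?_ ?_)
  · have := L.spanWord_opening t v
    rw [h, L.spanWord_opening t' v] at this
    exact (Option.some_inj.1 this).symm
  · have := L.spanWord_closing t v
    rw [h, L.spanWord_closing t' v] at this
    exact (Option.some_inj.1 this).symm

theorem isBoundedWord_spanWord (t : V → DocSpan d) :
    IsBoundedWord (d.length + 1) (Nat.card V + Nat.card V) (L.spanWord t) := by
  refine ⟨(L.length_spanWord t).le, fun x hx => ?_⟩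
  simp only [spanWord, List.mem_flatten, List.mem_ofFn, exists_exists_eq_and] at hx
  obtain ⟨i, hx⟩ := hx
  have := (t (L.var.symm i)).2
  simp only [List.mem_cons, List.not_mem_nil, or_false] at hx
  omega

variable {L} {c : ℕ → ℕ}

theorem IsPath.isAcceptingFrom {l : List (VSetLabel α V × Q)} : ∀ {i : ℕ} {q : Q},
    L.IsPath d c i q l → A.IsAcceptingFrom q l ∧
      (l.map Prod.fst).filterMap VSetLabel.letter? = d.drop i := by
  induction l with
  | nil =>
    rintro i q ⟨hq, rfl⟩
    exact ⟨hq, by simp⟩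
  | cons x l ih =>
    obtain ⟨o, q'⟩ := x
    rintro i q ⟨ht, hok, h⟩
    obtain ⟨h1, h2⟩ := ih h
    refine ⟨⟨ht, h1⟩, ?_⟩
    cases o with
    | letter a =>
      obtain ⟨hi, rfl⟩ := List.getElem?_eq_some_iff.1 hok
      simp only [List.drop_eq_getElem_cons hi, List.map_cons, VSetLabel.filterMap_letter_cons, h2,
        nextPos]
    | _ => rwa [List.map_cons, List.filterMap_cons_none rfl]

theorem IsPath.stepOk {l : List (VSetLabel α V × Q)} : ∀ {i : ℕ} {q : Q},
    L.IsPath d c i q l → ∀ (m : ℕ) (o : VSetLabel α V), (l.map Prod.fst)[m]? = some o →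
      L.StepOk d c (i + (((l.map Prod.fst).take m).filterMap VSetLabel.letter?).length) o := by
  induction l with
  | nil => simp
  | cons x l ih =>
    obtain ⟨o, q'⟩ := x
    rintro i q ⟨ht, hok, h⟩ m o' ho'
    cases m with
    | zero =>
      simp only [List.map_cons, List.getElem?_cons_zero, Option.some_inj] at ho'
      simpa [ho'] using hok
    | succ m =>
      have := ih h m o' (by simpa using ho')
      cases o with
      | letter a =>
        simp only [List.map_cons, List.take_succ_cons, VSetLabel.filterMap_letter_cons,
          List.length_cons]
        rw [nextPos, add_assoc, add_comm 1] at this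
        exact this
      | _ => rwa [List.map_cons, List.take_succ_cons, List.filterMap_cons_none rfl]

/-- The letters impose no condition of their own: that they spell the rest of the document already
makes each of them usable where it is read. -/
theorem isPath_of_isAcceptingFrom {l : List (VSetLabel α V × Q)} : ∀ {i : ℕ} {q : Q},
    A.IsAcceptingFrom q l → i ≤ d.length →
    (l.map Prod.fst).filterMap VSetLabel.letter? = d.drop i →
    (∀ (m : ℕ) (o : VSetLabel α V), (l.map Prod.fst)[m]? = some o → o.letter? = none →
      L.StepOk d c (i + (((l.map Prod.fst).take m).filterMap VSetLabel.letter?).length) o) →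
    L.IsPath d c i q l := by
  induction l with
  | nil =>
    intro i q hq hi hd _
    refine ⟨hq, le_antisymm hi ?_⟩
    simpa using hd.symm
  | cons x l ih =>
    obtain ⟨o, q'⟩ := x
    rintro i q ⟨ht, hacc⟩ hi hd hok
    by_cases ho : o.letter? = none
    · have hn : nextPos i o = i := by
        cases o <;> first | rfl | simp [VSetLabel.letter?] at ho
      rw [List.map_cons, List.filterMap_cons_none ho] at hd
      refine ⟨ht, by simpa using hok 0 o (by simp) ho, ?_⟩
      rw [hn]
      refine ih hacc hi hd fun m o' hm ho' => ?_
      have := hok (m + 1) o' (by simpa using hm) ho'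
      rwa [List.map_cons, List.take_succ_cons, List.filterMap_cons_none ho] at this
    · obtain ⟨a, rfl⟩ : ∃ a, o = .letter a := by
        cases o <;> simp [VSetLabel.letter?] at ho
        exact ⟨_, rfl⟩
      simp only [List.map_cons, VSetLabel.filterMap_letter_cons] at hd
      have hlt : i < d.length := by
        by_contra hge
        rw [List.drop_eq_nil_of_le (by omega)] at hd
        simp at hd
      rw [List.drop_eq_getElem_cons hlt, List.cons.injEq] at hd
      refine ⟨ht, ?_, ih hacc hlt hd.2 fun m o' hm ho' => ?_⟩
      · rw [StepOk, List.getElem?_eq_getElem hlt, hd.1]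
      · have := hok (m + 1) o' (by simpa using hm) ho'
        simp only [List.map_cons, List.take_succ_cons, VSetLabel.filterMap_letter_cons,
          List.length_cons] at this
        rwa [nextPos, add_assoc, add_comm 1]

end

end WeightedVSA.Listing

namespace VSetPath

variable {α V Q : Type*} {d : List α} {ρ : VSetPath α V Q}

theorem Valid.exists_selects (h : ρ.Valid) (hd : ρ.labels.filterMap VSetLabel.letter? = d) :
    ∃ t : V → DocSpan d, ρ.Selects t := by
  choose i j hij hi hj using h
  have hmono : Monotone ρ.pos := fun m n hmn => by
    unfold pos
    exact Nat.add_le_add_left (((List.take_sublist_take_left hmn).filterMap _).length_le) _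
  have hle : ∀ m, ρ.pos m ≤ d.length + 1 := fun m => by
    rw [pos, add_comm, ← hd]
    exact Nat.add_le_add_right (((List.take_sublist m _).filterMap _).length_le) _
  exact ⟨fun v => ⟨(ρ.pos (i v), ρ.pos (j v)), by simp [pos], hmono (hij v).le, hle _⟩, fun v =>
    ⟨i v, j v, (hi v _).2 rfl, (hj v _).2 rfl, rfl⟩⟩

theorem Valid.pos_opening (h : ρ.Valid) {t : V → DocSpan d} (ht : ρ.Selects t) {m : ℕ} {v : V}
    (hm : ρ.labels[m]? = some (.opening v)) : ρ.pos m = (t v).1.1 := by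
  obtain ⟨i, j, -, hi, -⟩ := h v
  obtain ⟨i', j', hi', -, he⟩ := ht v
  rw [he, (hi m).1 hm, (hi i').1 hi']

theorem Valid.pos_closing (h : ρ.Valid) {t : V → DocSpan d} (ht : ρ.Selects t) {m : ℕ} {v : V}
    (hm : ρ.labels[m]? = some (.closing v)) : ρ.pos m = (t v).1.2 := by
  obtain ⟨i, j, -, -, hj⟩ := h v
  obtain ⟨i', j', -, hj', he⟩ := ht v
  rw [he, (hj m).1 hm, (hj j').1 hj']

end VSetPath

/-! ### Prefixes and runs; bounds from the transitions -/

namespace WeightedVSA.Listing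

section

variable {K α V Q : Type*} [CommSemiring K] {A : WeightedVSA K α V Q} {L : A.Listing}
  {d : List α} {w : List ℕ} {ρ : VSetPath α V Q} {t : V → DocSpan d}

/-- In a valid run each variable operation occurs at exactly one place, so the constraint checked
there concerns the very bound that enters the tuple. Entries of `w` are positive and cannot be
mistaken for `0`, which stands for no constraint and fills the array after `w`. -/
theorem isPath_iff_isPrefix (hw : IsBoundedWord (d.length + 1) (Nat.card V + Nat.card V) w)
    (hρ : A.IsRun d ρ) (hv : ρ.Valid) (ht : ρ.Selects t) :
    L.IsPath d (arrayOf w) 0 ρ.start ρ.steps ↔ w <+: L.spanWord t := by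
  have hpos : ∀ m, ρ.pos m = 0 + ((ρ.labels.take m).filterMap VSetLabel.letter?).length + 1 :=
    fun m => by rw [VSetPath.pos]; omega
  constructor
  · intro h
    have key : ∀ (k m x : ℕ) (hk : k < w.length), (arrayOf w k = 0 ∨ arrayOf w k = ρ.pos m) →
        (L.spanWord t)[k]? = some x → ρ.pos m = x → (L.spanWord t)[k]? = some w[k] := by
      intro k m x hk hor hx hm
      rw [arrayOf_of_lt hk] at hor
      have := (hw.2 _ (List.getElem_mem hk)).1
      rw [hx, ← hm]
      congr 1
      omega
    rw [List.prefix_iff_getElem?]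
    intro k hk
    have hkV : k / 2 < Nat.card V := by
      have := hw.1
      omega
    obtain ⟨v, hvk⟩ := L.var.surjective ⟨k / 2, hkV⟩
    have hvk : (L.var v : ℕ) = k / 2 := by rw [hvk]
    obtain ⟨i, j, hi, hj, -⟩ := ht v
    rcases Nat.even_or_odd' k with ⟨n, rfl | rfl⟩
    · have h1 := h.stepOk i _ hi
      have h2 := L.spanWord_opening t v
      rw [StepOk] at h1
      rw [show (L.var v + L.var v : ℕ) = 2 * n by omega] at h1 h2
      exact key _ i _ hk (hpos i ▸ h1) h2 (hv.pos_opening ht hi)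
    · have h1 := h.stepOk j _ hj
      have h2 := L.spanWord_closing t v
      rw [StepOk] at h1
      rw [show (L.var v + L.var v + 1 : ℕ) = 2 * n + 1 by omega] at h1 h2
      exact key _ j _ hk (hpos j ▸ h1) h2 (hv.pos_closing ht hj)
  · intro h
    have key : ∀ k x, (L.spanWord t)[k]? = some x → arrayOf w k = 0 ∨ arrayOf w k = x := by
      intro k x hx
      rcases lt_or_ge k w.length with hk | hk
      · right
        rw [List.prefix_iff_getElem?] at h
        rw [arrayOf_of_lt hk, ← Option.some_inj, ← h k hk, hx]
      · exact .inl (arrayOf_of_le hk)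
    refine isPath_of_isAcceptingFrom hρ.2.1 (Nat.zero_le _) hρ.2.2 fun m o hm ho => ?_
    cases o with
    | eps => trivial
    | letter a => simp [VSetLabel.letter?] at ho
    | opening v =>
      have h1 := key _ _ (L.spanWord_opening t v)
      rw [← hv.pos_opening ht hm, hpos] at h1
      exact h1
    | closing v =>
      have h1 := key _ _ (L.spanWord_closing t v)
      rw [← hv.pos_closing ht hm, hpos] at h1
      exact h1

theorem labels_subset {l : List (VSetLabel α V × Q)} : ∀ {q : Q}, A.IsAcceptingFrom q l →
    l.map Prod.fst ⊆ L.transitions.map fun x => x.2.1 := by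
  induction l with
  | nil => simp
  | cons x l ih =>
    obtain ⟨o, q'⟩ := x
    rintro q ⟨ht, h⟩
    rw [List.map_cons, List.cons_subset]
    exact ⟨List.mem_map.2 ⟨_, (L.mem_iff _ _ _).2 ht, rfl⟩, ih h⟩

/-- By validity a variable operation occurs at most once, and it labels some transition. Apart from
`ε`, a run thus has at most `|d|` letters and as many operations as there are transitions;
`exists_length_bound` accounts for `ε`. The number of variables does not enter, so the program can
compute the bound within the time allowed. -/
theorem length_steps_le [Finite Q] (hA : A.NoEpsCycles) (hρ : A.IsRun d ρ) (hv : ρ.Valid) :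
    ρ.steps.length ≤ (d.length + L.transitions.length + 1) * (Nat.card Q + 1) := by
  classical
  obtain ⟨h, hc, hb⟩ := A.exists_length_bound hA
  obtain ⟨w, hw, hwe, hle⟩ := hb ρ.steps ρ.start hρ.2.1
  have hsplit := List.length_eq_length_filter_add (l := w) (fun o => o.letter?.isSome)
  have h1 : (w.filter fun o => o.letter?.isSome).length ≤ d.length := by
    rw [← hρ.2.2]
    have := (hw.filterMap VSetLabel.letter?).length_le
    rwa [List.length_filterMap_eq_countP, List.countP_eq_length_filter] at this
  have h2 : (w.filter fun o => !o.letter?.isSome).length ≤ L.transitions.length := by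
    have hsub : (w.filter fun o => !o.letter?.isSome) ⊆ L.transitions.map fun x => x.2.1 :=
      fun o ho => labels_subset hρ.2.1 (hw.subset (List.mem_of_mem_filter ho))
    have hnd : (w.filter fun o => !o.letter?.isSome).Nodup := by
      rw [List.nodup_iff_count_le_one]
      intro o
      by_cases ho : o ∈ w.filter fun o => !o.letter?.isSome
      · rw [List.mem_filter] at ho
        refine (List.Sublist.count_le _ (List.filter_sublist.trans hw)).trans ?_
        have key : ∃ i : ℕ, ∀ k : ℕ, ρ.labels[k]? = some o ↔ k = i := by
          rcases o with _ | a | v | v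
          · exact absurd ho.1 hwe
          · simp [VSetLabel.letter?] at ho
          · obtain ⟨i, j, -, hi, -⟩ := hv v
            exact ⟨i, hi⟩
          · obtain ⟨i, j, -, -, hj⟩ := hv v
            exact ⟨j, hj⟩
        obtain ⟨i, hi⟩ := key
        by_contra hlt
        have hdup := List.duplicate_iff_two_le_count.2 (Nat.succ_le_of_lt (not_le.1 hlt))
        rw [List.duplicate_iff_exists_distinct_get] at hdup
        obtain ⟨n, m, hnm, hn, hm⟩ := hdup
        have e1 := (hi n).1 (by
          rw [VSetPath.labels, List.getElem?_eq_getElem n.2]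
          simpa using hn.symm)
        have e2 := (hi m).1 (by
          rw [VSetPath.labels, List.getElem?_eq_getElem m.2]
          simpa using hm.symm)
        exact absurd hnm (by simp [Fin.lt_def, e1, e2])
      · rw [List.count_eq_zero_of_not_mem ho]
        omega
    simpa using (hnd.subperm hsub).length_le
  calc ρ.steps.length ≤ w.length * (Nat.card Q + 1) + h ρ.start := hle
    _ ≤ (d.length + L.transitions.length) * (Nat.card Q + 1) + (Nat.card Q + 1) :=
      Nat.add_le_add (Nat.mul_le_mul_right _ (by omega)) ((hc _).trans (Nat.le_succ _))
    _ = _ := by ring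

/-- A valid run opens each variable, and distinct variables need distinct transitions. -/
theorem card_var_le (hρ : A.IsRun d ρ) (hv : ρ.Valid) : Nat.card V ≤ L.transitions.length := by
  have hnd : (List.ofFn fun i => (VSetLabel.opening (L.var.symm i) : VSetLabel α V)).Nodup := by
    rw [List.nodup_ofFn]
    intro i j h
    simpa using h
  have hsub : (List.ofFn fun i => (VSetLabel.opening (L.var.symm i) : VSetLabel α V)) ⊆
      L.transitions.map fun x => x.2.1 := by
    intro o ho
    obtain ⟨i, rfl⟩ := List.mem_ofFn.1 ho
    obtain ⟨m, -, -, hm, -⟩ := hv (L.var.symm i)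
    exact labels_subset hρ.2.1 (List.mem_of_getElem? ((hm m).2 rfl))
  simpa using (hnd.subperm hsub).length_le

variable (L) in
theorem size_eq : A.size = Nat.card Q + L.transitions.length := by
  classical
  rw [size, ← List.toFinset_card_of_nodup L.nodup, ← Set.ncard_coe_finset]
  congr 2
  ext ⟨p, o, q⟩
  simp [L.mem_iff]

end

end WeightedVSA.Listing

/-! ### Initialisation and the complete program -/

namespace RamProg

open RamNum (cell)

/-- Compute the start of the last row of the table and the number of rounds. -/
def prepare : RamProg :=
  .seq (forLoop 30 docLength (.setNum 20 (.const 0) (.add (cell 20) nStates)))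
    (forLoop 30 (.add (.add docLength nTransitions) (.const 1))
      (.setNum 21 (.const 0) (.add (cell 21) (.add nStates (.const 1)))))

/-- Create the root of the tree of prefixes of answers. -/
def initialise : RamProg :=
  .seq prepare (.seq bestRun
    (.seq (.setWt 4 (.const 0) (.load 5 (.const 0))) (.setNum 22 (.const 0) (.const 1))))

/-- Write the answers of a functional automaton on a document by descending weight. -/
def rankedAnswers : RamProg := .seq initialise answers

/-- A bound on the number of iterations of loops. -/
noncomputable def loopPoly : Polynomial ℕ :=
  (Polynomial.X + 1) * (Polynomial.X + 1) + 2 * Polynomial.X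

end RamProg

namespace WeightedVSA.Listing

open RamProg

variable {K α V Q : Type*} [CommSemiring K] [LinearOrder K] {A : WeightedVSA K α V Q}
  {L : A.Listing} {d : List α} {s : RamStore K} {Y : ℕ}

omit [LinearOrder K] in
variable (L) in
theorem inputIn_input (d : List α) : L.InputIn d (L.input d) := ⟨fun _ _ => rfl, fun _ _ => rfl⟩

/-- Both constants are products, obtained by repeated addition. -/
theorem ensures_prepare (hY : d.length + L.transitions.length + 1 ≤ Y) :
    Ensures Y prepare (L.IsReady d) (L.input d) := by
  have h := L.inputIn_input d
  refine .seq (.forLoop d.length (by omega) (fun k s => s.num 20 0 = k * Nat.card Q)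
    (by decide) (by decide) h.length_doc (by simp [input]) ?_ ?_)
  · intro k s hk h20 hF hs30
    have hs := h.of_frame hF (by decide) (by decide)
    refine .setNum ?_
    simp [RamNum.val, h20, hs.num_states, add_mul]
  intro s₁ h20 hF₁
  have h₁ := h.of_frame hF₁ (by decide) (by decide)
  have h21 : s₁.num 21 0 = 0 := by
    rw [hF₁.num 21 (by decide)]
    rfl
  refine .forLoop (d.length + L.transitions.length + 1) hY
    (fun k s => s.num 21 0 = k * (Nat.card Q + 1)) (by decide) (by decide)
    (by simp [RamNum.val, h₁.length_doc, h₁.num_transitions]) (by simpa using h21) ?_ ?_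
  · intro k s hk h21 hF hs30
    have hs := h₁.of_frame hF (by decide) (by decide)
    refine .setNum ?_
    simp only [RamNum.val, h21, hs.num_states, RamStore.setNum_num_self, ne_eq, Nat.reduceEqDiff,
      not_false_eq_true, RamStore.setNum_num_of_ne, Function.update_self, add_mul, one_mul]
  · intro s₂ h21 hF
    exact ⟨h₁.of_frame hF (by decide) (by decide), by rw [hF.num 20 (by decide), h20], h21⟩

variable (L) in
/-- The weights of words: the weight of a tuple for the word of the tuple, and `0` otherwise. -/
noncomputable def wordWeight (d : List α) (u : List ℕ) : K :=
  open Classical in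
  if h : ∃ t : V → DocSpan d, L.spanWord t = u then A.eval d h.choose else 0

omit [LinearOrder K] in
theorem wordWeight_spanWord (t : V → DocSpan d) : L.wordWeight d (L.spanWord t) = A.eval d t := by
  have h : ∃ t' : V → DocSpan d, L.spanWord t' = L.spanWord t := ⟨t, rfl⟩
  rw [wordWeight, dif_pos h, L.spanWord_injective h.choose_spec]

omit [LinearOrder K] in
theorem exists_of_wordWeight_ne_zero {u : List ℕ} (hu : L.wordWeight d u ≠ 0) :
    ∃ t : V → DocSpan d, L.spanWord t = u := by
  by_contra h
  exact hu (dif_neg h)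

variable [IsOrderedRing K] [Finite α] [Finite V] [Finite Q] (hnonneg : ∀ a : K, 0 ≤ a)
  (hbip : ∀ a b : K, a + b = a ∨ a + b = b) (hA : A.NoEpsCycles) (hfun : A.Functional)
include hnonneg hbip hA

/-- Finiteness of the set of runs, from `finite_runs`, makes the `finsum` in `eval` a genuine sum
and hence a maximum. -/
theorem isMaxOrZero_eval (t : V → DocSpan d) :
    IsMaxOrZero (A.weight '' {ρ | ρ ∈ A.runs d ∧ ρ.Selects t}) (A.eval d t) :=
  .finsum_mem hnonneg hbip ((A.finite_runs hA d).subset fun _ h => h.1) _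

include hfun

/-- An optimal path from an initial state is a run. Functionality makes it valid, so it selects a
tuple, whose weight is then neither smaller (it is a maximum over runs) nor larger (its own best run
obeys the same prefix). -/
theorem bestRunFinds (hd : d.length + 1 ≤ Y) (ht : L.transitions.length ≤ Y)
    (hN : (d.length + L.transitions.length + 1) * (Nat.card Q + 1) ≤ Y) :
    L.BestRunFinds d (L.wordWeight d) Y := by
  intro s w hs hw hc
  have hrun : ∀ q l, A.init q ≠ 0 → L.IsPath d (arrayOf w) 0 q l → A.IsRun d ⟨q, l⟩ := by
    intro q l hq hl
    obtain ⟨h1, h2⟩ := hl.isAcceptingFrom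
    exact ⟨hq, h1, h2⟩
  have hQ : Nat.card Q ≤ Y := by nlinarith
  refine (ensures_bestRun hnonneg hbip hs.toInputIn hs.lastRow hs.rounds (by gcongr <;> omega) hN
    hQ hd ht ?_).mono ?_
  · intro q l hq hl
    rw [hc] at hl
    exact length_steps_le hA (hrun q l hq hl) (hfun d _ (hrun q l hq hl))
  · intro s' _ hM
    rw [hc] at hM
    have hle : ∀ u ∈ Set.range (L.spanWord (d := d)), w <+: u →
        L.wordWeight d u ≤ s'.wt 5 0 := by
      rintro _ ⟨t, rfl⟩ hp
      rw [wordWeight_spanWord]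
      rcases (isMaxOrZero_eval hnonneg hbip hA t).eq with h0 | ⟨ρ, ⟨hρ, hsel⟩, he⟩
      · exact h0 ▸ hnonneg _
      · exact hM.le _ ⟨ρ.start, ρ.steps, (isPath_iff_isPrefix hw hρ.1 hρ.2.1 hsel).2 hp, he⟩
    refine ⟨?_, or_iff_not_imp_left.2 fun h0 => ?_⟩
    · rintro _ ⟨u, -, -, -, hp, rfl⟩
      by_cases hu : L.wordWeight d u = 0
      · exact hu ▸ hnonneg _
      · exact hle u (exists_of_wordWeight_ne_zero hu) hp
    · obtain ⟨q, l, hl, he⟩ := hM.eq.resolve_left h0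
      have hq : A.init q ≠ 0 := by
        intro hq
        rw [hq, zero_mul] at he
        exact h0 he.symm
      have hρ := hrun q l hq hl
      have hv := hfun d _ hρ
      obtain ⟨t, ht⟩ := hv.exists_selects hρ.2.2
      have hp := (isPath_iff_isPrefix hw hρ hv ht).1 hl
      refine ⟨L.spanWord t, L.isBoundedWord_spanWord t, L.length_spanWord t, by simp, hp,
        le_antisymm (hle _ ⟨t, rfl⟩ hp) ?_⟩
      rw [wordWeight_spanWord, ← he]
      refine (isMaxOrZero_eval hnonneg hbip hA t).le _ ⟨⟨q, l⟩, ⟨⟨hρ, hv, ?_⟩, ht⟩, rfl⟩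
      change A.init q * A.weightFrom q l ≠ 0
      rwa [he]

/-- The tree starts as a single root for the empty prefix; the cells for children, path and
positions are still zero from the input store. -/
theorem ensures_initialise (hd : d.length + 1 ≤ Y) (ht : L.transitions.length ≤ Y)
    (hN : (d.length + L.transitions.length + 1) * (Nat.card Q + 1) ≤ Y) :
    Ensures Y initialise (fun s => L.IsIdle d (L.wordWeight d) ∅ s fun _ => []) (L.input d) := by
  refine .seq ((ensures_prepare (by nlinarith)).mono fun s₁ hF₁ h₁ => .seq ?_)
  have hbounded : IsBoundedWord (d.length + 1) (Nat.card V + Nat.card V) [] := by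
    simp [IsBoundedWord]
  have e10 : s₁.num 10 = fun _ => 0 := hF₁.num 10 (by decide)
  have e11 : s₁.num 11 = fun _ => 0 := hF₁.num 11 (by decide)
  have e12 : s₁.num 12 = fun _ => 0 := hF₁.num 12 (by decide)
  refine (bestRunFinds hnonneg hbip hA hfun hd ht hN s₁ [] h₁ hbounded ?_).mono ?_
  · rw [e10]
    rfl
  · intro s₂ hF₂ hM
    have h₂ : L.IsReady d s₂ := h₁.of_frame hF₂ (by decide) (by decide)
    have e10 : s₂.num 10 = fun _ => 0 := by rw [hF₂.num 10 (by decide), e10]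
    have e11 : s₂.num 11 = fun _ => 0 := by rw [hF₂.num 11 (by decide), e11]
    have e12 : s₂.num 12 = fun _ => 0 := by rw [hF₂.num 12 (by decide), e12]
    refine .seq (.setWt (.setNum ?_))
    simp only [RamNum.val, RamWt.val]
    refine ⟨⟨⟨fun a ha => ?_, fun a ha => ?_⟩, ?_, ?_⟩, ⟨⟨?_, ?_, ?_, ?_, ?_, ?_, ?_, ?_⟩, ?_⟩,
      ?_, ?_⟩
    · simpa [show a ≠ 22 by omega] using h₂.num a ha
    · simpa [show a ≠ 4 by omega] using h₂.wt a ha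
    · simpa using h₂.lastRow
    · simpa using h₂.rounds
    · simp
    · rfl
    · exact fun n _ => hbounded
    · simp
    · simp [e11]
    · simp
    · simp [e11]
    · simp
    · simpa using hM
    · simp [e12]
    · simp [e10]

end WeightedVSA.Listing

theorem mainTheorem8 :
    ∃ (P : RamProg) (preprocessing delay : Polynomial ℕ),
      ∀ (K : Type*) [CommSemiring K] [LinearOrder K] [IsOrderedRing K],
        (∀ a : K, 0 ≤ a) → (∀ a b : K, a + b = a ∨ a + b = b) →
      ∀ (α V Q : Type*) [Finite α] [Finite V] [Finite Q] (A : WeightedVSA K α V Q),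
        A.NoEpsCycles → A.Functional →
      ∀ (L : A.Listing) (d : List α),
        P.RankedEnumerates A L d (preprocessing.eval (A.size + d.length))
          (delay.eval (A.size + d.length)) := by
  refine ⟨RamProg.rankedAnswers,
    (RamProg.initialise.costPoly + RamProg.searchPoly).comp RamProg.loopPoly,
    RamProg.delayPoly.comp RamProg.loopPoly, ?_⟩
  intro K _ _ _ hnonneg hbip α V Q _ _ _ A hA hfun L d
  set X := A.size + d.length with hX
  set Y := RamProg.loopPoly.eval X with hY
  -- The product bounds the number of rounds; the summand `2 * X` bounds the length `2|V|` of the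
  -- words if there is an answer.
  have hYX : Y = (X + 1) * (X + 1) + 2 * X := by simp [hY, RamProg.loopPoly]
  have hsize := L.size_eq
  have hd : d.length + 1 ≤ Y := by nlinarith
  have ht : L.transitions.length ≤ Y := by nlinarith
  have hN : (d.length + L.transitions.length + 1) * (Nat.card Q + 1) ≤ Y := by
    rw [hYX]
    refine (Nat.mul_le_mul ?_ ?_).trans (Nat.le_add_right _ _) <;> omega
  obtain ⟨m, s₁, hm, he₁, h₁⟩ :=
    WeightedVSA.Listing.ensures_initialise hnonneg hbip hA hfun hd ht hN
  have hsupp : ∀ u, L.wordWeight d u ≠ 0 → ∃ t : V → DocSpan d, L.spanWord t = u := fun u hu =>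
    WeightedVSA.Listing.exists_of_wordWeight_ne_zero hu
  obtain ⟨T, s', us, he, hnd, hmem, hsort, hen⟩ := WeightedVSA.Listing.exec_answers hnonneg hbip
    ((Set.finite_range (L.spanWord (d := d))).subset hsupp)
    (fun u hu => by
      obtain ⟨t, rfl⟩ := hsupp u hu
      exact ⟨L.isBoundedWord_spanWord t, L.length_spanWord t⟩)
    (WeightedVSA.Listing.bestRunFinds hnonneg hbip hA hfun hd ht hN) hd
    (fun u hu => by
      obtain ⟨t, rfl⟩ := hsupp u hu
      rw [WeightedVSA.Listing.wordWeight_spanWord] at hu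
      obtain ⟨ρ, ⟨hρ, -⟩, -⟩ :=
        (WeightedVSA.Listing.isMaxOrZero_eval hnonneg hbip hA t).eq.resolve_left hu
      have := WeightedVSA.Listing.card_var_le (L := L) hρ.1 hρ.2.1
      rw [hYX]
      nlinarith) h₁
  -- Words of nonzero weight come from tuples, so the list of words lifts to a list of tuples.
  obtain ⟨ts, rfl⟩ : ∃ ts : List (V → DocSpan d), ts.map L.spanWord = us := by
    have : us ∈ Set.range (List.map (L.spanWord (d := d))) := by
      rw [Set.range_list_map]
      exact fun u hu => hsupp u ((hmem u).1 hu).1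
    exact this
  refine ⟨ts, _, s', ⟨hnd.of_map _, fun t => ?_, ?_⟩, .seq he₁ he, ?_⟩
  · rw [← List.mem_map_of_injective L.spanWord_injective, hmem,
      WeightedVSA.Listing.wordWeight_spanWord]
    simp
  · simpa only [List.pairwise_map, WeightedVSA.Listing.wordWeight_spanWord] using hsort
  · rw [List.map_map] at hen
    refine (hen.silent_append m).mono ?_ ?_
    · simpa [hY] using hm
    · simp [hY]
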